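/- **Setting.** Let $G=(V,E)$ be a graph on $n$ vertices. A *trace* of $G$ is a random graph generated as follows. Each vertex of $G$ is sampled independently with probability $p_v$; let $V'\subseteq V$ be the set of sampled vertices and $G[V']$ the induced subgraph. In the *edge deletion model*, each edge of $G[V']$ is deleted independently with probability $1-p_e$. In the *edge flip model*, independently for each pair of distinct vertices of $V'$, the state of the pair is changed with probability $f_e$ (an edge is deleted, a non-edge becomes an edge). Traces are unlabeled: only the isomorphism class of each trace is observed. $\mathcal G(n,1/2)$ is the random graph on $n$ vertices in which each pair of vertices is an edge independently with probability $1/2$. We say that $m$ traces are *sufficient to reconstruct $G\sim\mathcal G(n,1/2)$ with probability at least $1-1/n$* if there is a function $R$ (which may depend on $n$, $m$ and the parameters of the model), mapping $m$-tuples of unlabeled traces to $n$-vertex graphs, such that, when $G\sim\mathcal G(n,1/2)$ and, given $G$, $T_1,\dots,T_m$ are independent traces of $G$, the graph $R(T_1,\dots,T_m)$ is isomorphic to $G$ with probability at least $1-1/n$, over the random choice of both $G$ and the traces. **Theorem (Upper bound for random graphs).** Let $p_v=p_v(n)\in[0,1]$ satisfy $p_v=\omega(\log n/\sqrt n)$ as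 $n\to\infty$, where $\log$ is the natural logarithm. 1. (Edge deletion.) Let $p_e=p_e(n)\in[0,1]$ satisfy $p_e=\omega\big(p_v^{-1/3}n^{-1/6}\sqrt{\log n}\big)$. Then, for all sufficiently large $n$, every number $m\ge 4\,p_v^{-2}p_e^{-1}\log n$ of edge deletion traces is sufficient to reconstruct $G\sim\mathcal G(n,1/2)$ with probability at least $1-1/n$. 2. (Edge flip.) Let $f_e=f_e(n)\in[0,1]$ satisfy $f_e\le 1/2$ for all sufficiently large $n$ and $\tfrac12-f_e=\omega\big(p_v^{-1/4}n^{-1/8}(\log n)^{3/8}\big)$. Then, for all sufficiently large $n$, every number $m\ge 12\,p_v^{-2}\big(\tfrac12-f_e\big)^{-2}\log n$ of edge flip traces is sufficient to reconstruct $G\sim\mathcal G(n,1/2)$ with probability at least $1-1/n$. -/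

import Mathlib

/-- A labelled trace of a graph on the vertex set `Fin n`: the set of sampled vertices together
with a graph on exactly these vertices. -/
abbrev LabelledTrace (n : ℕ) : Type := Σ S : Set (Fin n), SimpleGraph S

/-- Two labelled traces are identified when their graphs are isomorphic. -/
def labelledTraceSetoid (n : ℕ) : Setoid (LabelledTrace n) where
  r T T' := Nonempty (T.2 ≃g T'.2)
  iseqv :=
    { refl := fun _ => ⟨SimpleGraph.Iso.refl⟩
      symm := fun ⟨e⟩ => ⟨e.symm⟩
      trans := fun ⟨e⟩ ⟨e'⟩ => ⟨e.trans e'⟩ }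

/-- What is observed of a trace: its isomorphism class. The vertices carry no labels. -/
abbrev UnlabelledTrace (n : ℕ) : Type := Quotient (labelledTraceSetoid n)

/-- Forget the labels of the vertices of a trace. -/
def LabelledTrace.unlabel {n : ℕ} (T : LabelledTrace n) : UnlabelledTrace n :=
  Quotient.mk (labelledTraceSetoid n) T

/-- The edge deletion trace of `G` with sampled vertex set `S`, where `K` is the set of vertex
pairs whose edge, if there is one, is kept: the edges of `G[S]` that are not in `K` are deleted. -/
def deletionTrace {n : ℕ} (G : SimpleGraph (Fin n)) (ω : Set (Fin n) × SimpleGraph (Fin n)) :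
    LabelledTrace n :=
  ⟨ω.1, (G ⊓ ω.2).induce ω.1⟩

/-- The edge flip trace of `G` with sampled vertex set `S`, where `N` is the set of vertex
pairs whose state is flipped: in `G[S]`, edges in `N` are deleted, and non-adjacent pairs in `N`
become edges. -/
def flipTrace {n : ℕ} (G : SimpleGraph (Fin n)) (ω : Set (Fin n) × SimpleGraph (Fin n)) :
    LabelledTrace n :=
  ⟨ω.1, (symmDiff G ω.2).induce ω.1⟩

/-- The randomness of one trace: every vertex belongs to the sampled set independently with
probability `pv`, and, independently, every pair of distinct vertices is marked independently
with probability `q`. -/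
noncomputable def traceNoise (n : ℕ) (pv q : unitInterval) :
    MeasureTheory.Measure (Set (Fin n) × SimpleGraph (Fin n)) :=
  (ProbabilityTheory.setBernoulli Set.univ pv).prod (SimpleGraph.binomialRandom (Fin n) q)

/-- The number `1/2` as a probability. -/
noncomputable def oneHalf : unitInterval := ⟨1 / 2, by norm_num, by norm_num⟩

/-- The joint law of a random graph `G ∼ 𝒢(n, 1/2)` and of the mutually independent randomness of
`m` traces, which is also independent of `G`. -/
noncomputable def graphAndNoise (n m : ℕ) (pv q : unitInterval) :
    MeasureTheory.Measure (SimpleGraph (Fin n) × (Fin m → Set (Fin n) × SimpleGraph (Fin n))) :=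
  (SimpleGraph.binomialRandom (Fin n) oneHalf).prod
    (MeasureTheory.Measure.pi fun _ : Fin m => traceNoise n pv q)

/-- A reconstruction rule for `n`-vertex graphs from `m` unlabelled traces. -/
abbrev Reconstructor (n m : ℕ) : Type := (Fin m → UnlabelledTrace n) → SimpleGraph (Fin n)

/-- The probability, over `G ∼ 𝒢(n, 1/2)` and `m` independent edge deletion traces of `G`, that the
rule `R` outputs `G` (as an unlabelled graph, that is, up to isomorphism). -/
noncomputable def deletionSuccessProb {n m : ℕ} (pv pe : unitInterval) (R : Reconstructor n m) :
    ℝ :=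
  (graphAndNoise n m pv pe).real
    {x | Nonempty (R (fun i => (deletionTrace x.1 (x.2 i)).unlabel) ≃g x.1)}

/-- The probability, over `G ∼ 𝒢(n, 1/2)` and `m` independent edge flip traces of `G`, that the
rule `R` outputs `G` (as an unlabelled graph, that is, up to isomorphism). -/
noncomputable def flipSuccessProb {n m : ℕ} (pv fe : unitInterval) (R : Reconstructor n m) : ℝ :=
  (graphAndNoise n m pv fe).real
    {x | Nonempty (R (fun i => (flipTrace x.1 (x.2 i)).unlabel) ≃g x.1)}

/-!
# Reconstruction of random graphs from noisy traces

Only the number of traces is restricted, not the computation, so it suffices to find an event of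
large probability on which the unlabelled traces determine the graph up to isomorphism: the
reconstruction rule then outputs any graph in this event that is compatible with the traces
(`exists_reconstructor`). Both noise models are instances of one abstract model (`IsNoiseModel`),
in which every pair of vertices is an edge of a noisy graph with probability `r`, and of two noisy
graphs simultaneously with probability `r ^ 2 + γ`. The excess `γ` is `pe ^ 2 / 4` for edge
deletion and `(1 / 2 - fe) ^ 2` for edge flips.

*Alignment.* Two traces share about `k = pv ^ 2 * n` vertices. A vertex `u` of one trace and a
vertex `w` of another one are declared equal if some matching of about `k` vertices takes `u` to
`w` and gives every matched vertex at least the fraction `r ^ 2 + γ / 2` of common neighbours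
(`Aligned`). This criterion does not see labels. For `u = w` the identity on the common vertices is
such a matching. Suppose that `u ≠ w`. If the matching moves at most `γ k / 8` vertices, then up to
this error the common neighbours of `u` and `w` are counted along the identity, and their fraction
is close to `r ^ 2`. If it moves `d ≥ γ k / 8` of its `K` vertices, then about `d K` pairs of
vertices are compared with other pairs. The comparison is a partial injection without fixed points,
hence three-colourable with independent terms in each colour class (`exists_three_colouring`), and
a Chernoff bound gives a probability `exp (-c γ ^ 2 d K) ≤ exp (-c' γ ^ 3 k K)`. This beats the
number `n ^ (2 K)` of matchings as soon as `γ ^ 3 k` is a large multiple of `log n`, which is what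
the hypotheses provide with room to spare.

*Gluing and decision.* On the event that all traces in use are pairwise aligned correctly,
isomorphisms between two systems of traces glue to a permutation of the vertices
(`Decodable.nonempty_iso`). It remains to find the edges from the aligned traces: a pair is declared
an edge if it is seen as an edge at least once (deletion), or in the majority of the traces that
contain both vertices (flips). The constants `4` and `12` make the error probability of each pair at
most `n ^ (-4)`. Only the first few traces are used, so that the union bound over pairs of traces is
over polynomially many pairs.
-/

open MeasureTheory ProbabilityTheory

/-! ### Independent bits -/

section Bits

variable {Ω Ω' ι κ : Type*}

/-- The random object `f` is a function of the bits `B t` with `t ∈ T`. -/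
def DependsOnBits {α : Type*} (B : ι → Ω → Prop) (T : Finset ι) (f : Ω → α) : Prop :=
  ∀ ω ω', (∀ t ∈ T, B t ω ↔ B t ω') → f ω = f ω'

theorem DependsOnBits.comp {α β : Type*} {B : ι → Ω → Prop} {T : Finset ι} {f : Ω → α}
    (hf : DependsOnBits B T f) (g : α → β) : DependsOnBits B T (fun ω => g (f ω)) :=
  fun ω ω' h => congrArg g (hf ω ω' h)

theorem DependsOnBits.prod {B : ι → Ω → Prop} [DecidableEq ι] {F : Finset κ} {T : κ → Finset ι}
    {f : κ → Ω → ℝ} (hf : ∀ c ∈ F, DependsOnBits B (T c) (f c)) :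
    DependsOnBits B (F.biUnion T) (fun ω => ∏ c ∈ F, f c ω) := by
  intro ω ω' h
  refine Finset.prod_congr rfl fun c hc => hf c hc ω ω' fun t ht => h t ?_
  exact Finset.mem_biUnion.2 ⟨c, hc, ht⟩

/-- A function of the bits in `T` factors through the tuple of these bits. -/
theorem DependsOnBits.exists_eq_comp {α : Type*} [Nonempty α] {B : ι → Ω → Prop} {T : Finset ι}
    {f : Ω → α} (hf : DependsOnBits B T f) :
    ∃ F : (T → Prop) → α, f = F ∘ fun a (i : T) => B i a := by
  refine ⟨Function.extend (fun a (i : T) => B i a) f (fun _ => Classical.arbitrary α), ?_⟩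
  have hfac : Function.FactorsThrough f (fun a (i : T) => B i a) := fun ω ω' he =>
    hf ω ω' fun t ht => Iff.of_eq (congrFun he ⟨t, ht⟩)
  exact (hfac.extend_comp _).symm

variable [MeasurableSpace Ω] [MeasurableSpace Ω']

/-- Functions of disjoint sets of independent bits are independent. -/
theorem indepFun_of_dependsOnBits {α β : Type*} [MeasurableSpace α] [MeasurableSpace β]
    [Nonempty α] [Nonempty β] [DiscreteMeasurableSpace Ω] {μ : Measure Ω}
    {B : ι → Ω → Prop} (hB : iIndepFun B μ) {S T : Finset ι} (hST : Disjoint S T)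
    {f : Ω → α} {g : Ω → β} (hf : DependsOnBits B S f) (hg : DependsOnBits B T g) :
    IndepFun f g μ := by
  have key := hB.indepFun_finset S T hST (fun i => .of_discrete)
  obtain ⟨F, rfl⟩ := hf.exists_eq_comp
  obtain ⟨G, rfl⟩ := hg.exists_eq_comp
  exact key.comp .of_discrete .of_discrete

theorem integral_mul_of_dependsOnBits [Finite Ω] [DiscreteMeasurableSpace Ω] {μ : Measure Ω}
    {B : ι → Ω → Prop} (hB : iIndepFun B μ) {S T : Finset ι} (hST : Disjoint S T)
    {f g : Ω → ℝ} (hf : DependsOnBits B S f) (hg : DependsOnBits B T g) :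
    ∫ ω, f ω * g ω ∂μ = (∫ ω, f ω ∂μ) * ∫ ω, g ω ∂μ :=
  (indepFun_of_dependsOnBits hB hST hf hg).integral_mul_eq_mul_integral
    (Measurable.of_discrete.aestronglyMeasurable) (Measurable.of_discrete.aestronglyMeasurable)

/-- The expectation of a product of functions of pairwise disjoint sets of independent bits. -/
theorem integral_prod_of_dependsOnBits [Finite Ω] [DiscreteMeasurableSpace Ω] {μ : Measure Ω}
    {B : ι → Ω → Prop} (hB : iIndepFun B μ) {F : Finset κ} {T : κ → Finset ι}
    (hT : (F : Set κ).PairwiseDisjoint T) {f : κ → Ω → ℝ}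
    (hf : ∀ c ∈ F, DependsOnBits B (T c) (f c)) :
    ∫ ω, ∏ c ∈ F, f c ω ∂μ = ∏ c ∈ F, ∫ ω, f c ω ∂μ := by
  classical
  have := hB.isProbabilityMeasure
  induction F using Finset.induction_on with
  | empty => simp
  | insert a F ha ih =>
    simp only [Finset.prod_insert ha]
    rw [integral_mul_of_dependsOnBits hB (S := T a) (T := F.biUnion T) ?_
      (hf a (by simp)) (DependsOnBits.prod fun c hc => hf c (by simp [hc])),
      ih (hT.subset (by simp)) fun c hc => hf c (by simp [hc])]
    rw [Finset.disjoint_biUnion_right]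
    intro c hc
    exact hT (by simp) (by simp [hc]) (fun h => ha (h ▸ hc))

theorem iIndepFun_map_iff {α : ι → Type*} {mα : ∀ i, MeasurableSpace (α i)} {P : Measure Ω}
    {φ : Ω → Ω'} (hφ : Measurable φ) {f : ∀ i, Ω' → α i} (hf : ∀ i, Measurable (f i)) :
    iIndepFun f (P.map φ) ↔ iIndepFun (fun i ω => f i (φ ω)) P := by
  simp only [iIndepFun_iff_measure_inter_preimage_eq_mul]
  refine forall_congr' fun S => forall_congr' fun sets => forall_congr' fun hs => ?_
  have e : ∀ i ∈ S, MeasurableSet (f i ⁻¹' sets i) := fun i hi => hf i (hs i hi)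
  rw [Measure.map_apply hφ (S.measurableSet_biInter e),
    Finset.prod_congr rfl fun i hi => Measure.map_apply hφ (e i hi)]
  simp only [Set.preimage_iInter]
  rfl

/-- Independent families on the two factors of a product space are jointly independent. -/
theorem iIndepFun_sumElim_prod {α : Type*} [MeasurableSpace α] {P : Measure Ω} {Q : Measure Ω'}
    {f : ι → Ω → α} {g : κ → Ω' → α} (hf : iIndepFun f P) (hg : iIndepFun g Q) :
    iIndepFun (fun (t : ι ⊕ κ) (x : Ω × Ω') =>
      Sum.elim (fun i => f i x.1) (fun j => g j x.2) t) (P.prod Q) := by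
  have := hf.isProbabilityMeasure
  have := hg.isProbabilityMeasure
  rw [iIndepFun_iff_measure_inter_preimage_eq_mul] at hf hg ⊢
  intro S sets hs
  have hset : (⋂ t ∈ S, (fun x : Ω × Ω' =>
      Sum.elim (fun i => f i x.1) (fun j => g j x.2) t) ⁻¹' sets t) =
      (⋂ i ∈ S.toLeft, f i ⁻¹' sets (.inl i)) ×ˢ (⋂ j ∈ S.toRight, g j ⁻¹' sets (.inr j)) := by
    ext ⟨x, y⟩
    simp [Sum.forall]
  rw [hset, Measure.prod_prod, hf _ (fun i hi => hs _ (by simpa using hi)),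
    hg _ (fun i hi => hs _ (by simpa using hi))]
  conv_rhs => rw [← Finset.toLeft_disjSum_toRight (u := S)]
  rw [Finset.prod_disjSum]
  congr 1
  · refine Finset.prod_congr rfl fun i _ => ?_
    have : (fun x : Ω × Ω' => Sum.elim (fun i => f i x.1) (fun j => g j x.2) (Sum.inl i)) ⁻¹'
      sets (.inl i) = (f i ⁻¹' sets (.inl i)) ×ˢ Set.univ := by ext; simp
    rw [this, Measure.prod_prod]; simp
  · refine Finset.prod_congr rfl fun i _ => ?_
    have : (fun x : Ω × Ω' => Sum.elim (fun i => f i x.1) (fun j => g j x.2) (Sum.inr i)) ⁻¹'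
      sets (.inr i) = Set.univ ×ˢ (g i ⁻¹' sets (.inr i)) := by ext; simp
    rw [this, Measure.prod_prod]; simp

end Bits

/-! ### The bits of a random graph and of its traces -/

section GraphBits

/-- On finitely many vertices every set of graphs is measurable. -/
instance instDiscreteMeasurableSpaceSimpleGraph {V : Type*} [Finite V] :
    DiscreteMeasurableSpace (SimpleGraph V) where
  forall_measurableSet s := by
    have h : MeasurableSet (SimpleGraph.edgeSet '' s) := .of_discrete
    have := (SimpleGraph.measurable_edgeSet (V := V)) h
    rwa [Set.preimage_image_eq _ SimpleGraph.edgeSet_injective] at this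

open unitInterval in
theorem iIndepFun_mem_setBernoulli {V : Type*} [Countable V] (u : Set V) (p : unitInterval) :
    iIndepFun (fun (v : V) (S : Set V) => v ∈ S) (setBernoulli u p) := by
  rw [setBernoulli_eq_map]
  refine (iIndepFun_map_iff MeasurableEquiv.setOfPred.measurable
    (fun i => measurable_set_mem i)).2 ?_
  exact iIndepFun_infinitePi (X := fun _ x => x) (fun _ => measurable_id)

open unitInterval in
theorem setBernoulli_real_mem {V : Type*} [Countable V] {u : Set V} (p : unitInterval) {v : V}
    (hv : v ∈ u) : (setBernoulli u p).real {S | v ∈ S} = p := by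
  have hm : Measurable (fun p : V → Prop => {i | p i}) := MeasurableEquiv.setOfPred.measurable
  rw [setBernoulli_eq_map, map_measureReal_apply hm (measurable_set_mem v).setOf]
  have : (fun p : V → Prop => {i | p i}) ⁻¹' {S | v ∈ S} = (fun ω => ω v) ⁻¹' {True} := by
    ext; simp
  rw [this, ← map_measureReal_apply (measurable_pi_apply v) .of_discrete,
    Measure.infinitePi_map_eval]
  simp [measureReal_def, hv]

theorem iIndepFun_mem_edgeSet_binomialRandom {V : Type*} [Countable V] (p : unitInterval) :
    iIndepFun (fun (e : Sym2 V) (G : SimpleGraph V) => e ∈ G.edgeSet)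
      (SimpleGraph.binomialRandom V p) := by
  have h := iIndepFun_mem_setBernoulli (Sym2.diagSetᶜ : Set (Sym2 V)) p
  rw [SimpleGraph.binomialRandom_eq_map]
  refine (iIndepFun_map_iff SimpleGraph.measurable_fromEdgeSet
    (fun e => (measurable_set_mem e).comp SimpleGraph.measurable_edgeSet)).2 ?_
  have := h.comp (fun e x => x ∧ e ∉ Sym2.diagSet) (fun e => .of_discrete)
  convert this using 2 with e
  ext S
  simp [SimpleGraph.edgeSet_fromEdgeSet]

theorem binomialRandom_real_mem_edgeSet {V : Type*} [Countable V] (p : unitInterval) {e : Sym2 V}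
    (he : ¬ e.IsDiag) : (SimpleGraph.binomialRandom V p).real {G | e ∈ G.edgeSet} = p := by
  have hm : MeasurableSet {G : SimpleGraph V | e ∈ G.edgeSet} :=
    ((measurable_set_mem e).comp SimpleGraph.measurable_edgeSet).setOf
  rw [SimpleGraph.binomialRandom_eq_map,
    map_measureReal_apply SimpleGraph.measurable_fromEdgeSet hm,
    ← setBernoulli_real_mem (u := (Sym2.diagSetᶜ : Set (Sym2 V))) p (v := e) (by simpa using he)]
  congr 1
  ext S
  simp [SimpleGraph.edgeSet_fromEdgeSet, he]

/-- The sample space of a random graph together with the noise of `m` traces. -/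
abbrev NoiseSpace (n m : ℕ) : Type :=
  SimpleGraph (Fin n) × (Fin m → Set (Fin n) × SimpleGraph (Fin n))

/-- Labels of the independent bits that make up a graph and the noise of `m` traces: the pairs of
vertices of the graph and, for each trace, the vertices and the pairs of vertices. -/
abbrev BitIndex (n m : ℕ) : Type := Sym2 (Fin n) ⊕ (Fin m × (Fin n ⊕ Sym2 (Fin n)))

/-- The bits of a graph and of the noise of its traces. -/
def noiseBit {n m : ℕ} : BitIndex n m → NoiseSpace n m → Prop
  | .inl e, x => e ∈ x.1.edgeSet
  | .inr (i, .inl v), x => v ∈ (x.2 i).1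
  | .inr (i, .inr e), x => e ∈ (x.2 i).2.edgeSet

instance (n : ℕ) (pv q : unitInterval) : IsProbabilityMeasure (traceNoise n pv q) := by
  unfold traceNoise; infer_instance

instance (n m : ℕ) (pv q : unitInterval) : IsProbabilityMeasure (graphAndNoise n m pv q) := by
  unfold graphAndNoise; infer_instance

theorem iIndepFun_noiseBit (n m : ℕ) (pv q : unitInterval) :
    iIndepFun (noiseBit (n := n) (m := m)) (graphAndNoise n m pv q) := by
  have h1 := iIndepFun_sumElim_prod (iIndepFun_mem_setBernoulli (Set.univ : Set (Fin n)) pv)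
    (iIndepFun_mem_edgeSet_binomialRandom (V := Fin n) q)
  have h2 : iIndepFun (fun (t : Fin m × (Fin n ⊕ Sym2 (Fin n)))
      (ω : Fin m → Set (Fin n) × SimpleGraph (Fin n)) =>
      Sum.elim (fun v => v ∈ (ω t.1).1) (fun e => e ∈ (ω t.1).2.edgeSet) t.2)
      (Measure.pi fun _ : Fin m => traceNoise n pv q) := by
    refine iIndepFun_uncurry' (X := fun (i : Fin m) (t : Fin n ⊕ Sym2 (Fin n))
      (ω : Fin m → Set (Fin n) × SimpleGraph (Fin n)) =>
      Sum.elim (fun v => v ∈ (ω i).1) (fun e => e ∈ (ω i).2.edgeSet) t)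
      (fun _ _ => .of_discrete) ?_ ?_
    · exact iIndepFun_pi (X := fun _ (x : Set (Fin n) × SimpleGraph (Fin n)) t =>
        Sum.elim (fun v => v ∈ x.1) (fun e => e ∈ x.2.edgeSet) t)
        (fun _ => Measurable.of_discrete.aemeasurable)
    · intro i
      have := (measurePreserving_eval (fun _ : Fin m => traceNoise n pv q) i).map_eq
      have h1' : iIndepFun _ (traceNoise n pv q) := h1
      rw [← this] at h1'
      exact (iIndepFun_map_iff (α := fun _ => Prop)
        (P := Measure.pi fun _ : Fin m => traceNoise n pv q)
        (φ := Function.eval i) (measurable_pi_apply i)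
        (f := fun (t : Fin n ⊕ Sym2 (Fin n)) (x : Set (Fin n) × SimpleGraph (Fin n)) =>
          Sum.elim (fun v => v ∈ x.1) (fun e => e ∈ x.2.edgeSet) t)
        (fun _ => .of_discrete)).1 h1'
  have h3 := iIndepFun_sumElim_prod
    (iIndepFun_mem_edgeSet_binomialRandom (V := Fin n) oneHalf) h2
  unfold graphAndNoise
  convert h3 using 1
  funext t x
  rcases t with e | ⟨i, v | e⟩ <;> rfl

theorem graphAndNoise_map_eval {n m : ℕ} (pv q : unitInterval) (i : Fin m) :
    (graphAndNoise n m pv q).map (fun x => x.2 i) = traceNoise n pv q := by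
  have h := (measurePreserving_eval (fun _ : Fin m => traceNoise n pv q) i).comp
    (measurePreserving_snd (μ := SimpleGraph.binomialRandom (Fin n) oneHalf)
      (ν := Measure.pi fun _ : Fin m => traceNoise n pv q))
  exact h.map_eq

theorem graphAndNoise_real_edge {n m : ℕ} (pv q : unitInterval) {e : Sym2 (Fin n)}
    (he : ¬ e.IsDiag) :
    (graphAndNoise n m pv q).real {x | noiseBit (.inl e) x} = 1 / 2 := by
  have h := binomialRandom_real_mem_edgeSet oneHalf he
  have h' := (measurePreserving_fst (μ := SimpleGraph.binomialRandom (Fin n) oneHalf)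
      (ν := Measure.pi fun _ : Fin m => traceNoise n pv q)).map_eq
  rw [← h', map_measureReal_apply measurable_fst .of_discrete] at h
  exact h

theorem graphAndNoise_real_vertex {n m : ℕ} (pv q : unitInterval) (i : Fin m) (v : Fin n) :
    (graphAndNoise n m pv q).real {x | noiseBit (.inr (i, .inl v)) x} = pv := by
  have h := setBernoulli_real_mem (u := Set.univ) pv (Set.mem_univ v)
  have h' := (measurePreserving_fst (μ := setBernoulli (Set.univ : Set (Fin n)) pv)
      (ν := SimpleGraph.binomialRandom (Fin n) q)).map_eq
  rw [← h', map_measureReal_apply measurable_fst .of_discrete] at h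
  change (traceNoise n pv q).real _ = _ at h
  rw [← graphAndNoise_map_eval pv q i, map_measureReal_apply .of_discrete .of_discrete] at h
  exact h

theorem graphAndNoise_real_mark {n m : ℕ} (pv q : unitInterval) (i : Fin m) {e : Sym2 (Fin n)}
    (he : ¬ e.IsDiag) :
    (graphAndNoise n m pv q).real {x | noiseBit (.inr (i, .inr e)) x} = q := by
  have h := binomialRandom_real_mem_edgeSet q he
  have h' := (measurePreserving_snd (μ := setBernoulli (Set.univ : Set (Fin n)) pv)
      (ν := SimpleGraph.binomialRandom (Fin n) q)).map_eq
  rw [← h', map_measureReal_apply measurable_snd .of_discrete] at h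
  change (traceNoise n pv q).real _ = _ at h
  rw [← graphAndNoise_map_eval pv q i, map_measureReal_apply .of_discrete .of_discrete] at h
  exact h

end GraphBits

/-! ### Indicators and exponential moments -/

/-- The indicator of a proposition, as a real number. -/
noncomputable def ind (p : Prop) : ℝ := open Classical in if p then 1 else 0

section Indicator

variable {p q : Prop}

theorem ind_of_true (h : p) : ind p = 1 := if_pos h

theorem ind_of_false (h : ¬ p) : ind p = 0 := if_neg h

theorem ind_and : ind (p ∧ q) = ind p * ind q := by
  by_cases hp : p <;> by_cases hq : q <;> simp [ind, hp, hq]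

theorem ind_sq : ind p ^ 2 = ind p := by
  by_cases hp : p <;> simp [ind, hp]

theorem ind_nonneg : 0 ≤ ind p := by
  by_cases hp : p <;> simp [ind, hp]

theorem ind_le_one : ind p ≤ 1 := by
  by_cases hp : p <;> simp [ind, hp]

theorem sum_ind {κ : Type*} (F : Finset κ) (P : κ → Prop) [DecidablePred P] :
    ∑ c ∈ F, ind (P c) = ((F.filter P).card : ℝ) := by
  rw [Finset.card_filter]
  push_cast
  refine Finset.sum_congr rfl fun c _ => ?_
  by_cases h : P c <;> simp [ind, h]

variable {Ω : Type*} [MeasurableSpace Ω] [DiscreteMeasurableSpace Ω]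

theorem integral_ind (μ : Measure Ω) (P : Ω → Prop) :
    ∫ ω, ind (P ω) ∂μ = μ.real {ω | P ω} := by
  rw [← integral_indicator_one (μ := μ) (s := {ω | P ω}) .of_discrete]
  refine integral_congr_ae (.of_forall fun ω => ?_)
  by_cases h : P ω <;> simp [ind, h]

end Indicator

section Chernoff

variable {Ω ι κ : Type*} [Finite Ω] [MeasurableSpace Ω] [DiscreteMeasurableSpace Ω]
  {μ : Measure Ω}

theorem Real.exp_le_one_add_add_sq {x : ℝ} (hx : |x| ≤ 1) : Real.exp x ≤ 1 + x + x ^ 2 := by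
  have := (abs_le.1 (Real.abs_exp_sub_one_sub_id_le hx)).2
  linarith

/-- A bound for an exponential moment in terms of the first two moments. -/
theorem integral_exp_mul_le [IsProbabilityMeasure μ] {Y : Ω → ℝ} {g v l : ℝ} (hl : 0 ≤ l)
    (hY : ∀ ω, |l * Y ω| ≤ 1) (h1 : ∫ ω, Y ω ∂μ ≤ -(g * v)) (h2 : ∫ ω, Y ω ^ 2 ∂μ ≤ v) :
    ∫ ω, Real.exp (l * Y ω) ∂μ ≤ Real.exp (-(l * g * v) + l ^ 2 * v) := by
  have hi : ∀ f : Ω → ℝ, Integrable f μ := fun f => .of_finite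
  calc ∫ ω, Real.exp (l * Y ω) ∂μ ≤ ∫ ω, (1 + l * Y ω + l ^ 2 * Y ω ^ 2) ∂μ := by
        refine integral_mono (hi _) (hi _) fun ω => ?_
        have := Real.exp_le_one_add_add_sq (hY ω)
        simpa only [mul_pow] using this
    _ = 1 + l * ∫ ω, Y ω ∂μ + l ^ 2 * ∫ ω, Y ω ^ 2 ∂μ := by
        rw [integral_add (hi _) (hi _), integral_add (hi _) (hi _), integral_const_mul,
          integral_const_mul]
        simp
    _ ≤ 1 + (-(l * g * v) + l ^ 2 * v) := by
        nlinarith [mul_le_mul_of_nonneg_left h1 hl, mul_le_mul_of_nonneg_left h2 (sq_nonneg l)]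
    _ ≤ _ := by linarith [Real.add_one_le_exp (-(l * g * v) + l ^ 2 * v)]

/-- A Chernoff bound of Bernstein type: a sum of independent bounded variables with variances
proportional to `v` and with means at most `-g v` rarely reaches `t ≥ 0`. -/
theorem measureReal_le_sum_le_exp {B : ι → Ω → Prop} (hB : iIndepFun B μ) {F : Finset κ}
    {T : κ → Finset ι} (hT : (F : Set κ).PairwiseDisjoint T) {Y : κ → Ω → ℝ}
    (hYT : ∀ c ∈ F, DependsOnBits B (T c) (Y c)) {g v : ℝ} (hg : 0 ≤ g) (hg1 : g ≤ 1)
    (hY : ∀ c ∈ F, ∀ ω, |Y c ω| ≤ 2) (h1 : ∀ c ∈ F, ∫ ω, Y c ω ∂μ ≤ -(g * v))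
    (h2 : ∀ c ∈ F, ∫ ω, Y c ω ^ 2 ∂μ ≤ v) (t : ℝ) :
    μ.real {ω | t ≤ ∑ c ∈ F, Y c ω} ≤ Real.exp (-(g / 2 * t) - F.card * (g ^ 2 * v / 4)) := by
  have := hB.isProbabilityMeasure
  -- The exponent `g / 2` minimizes the bound of `integral_exp_mul_le`.
  have hl : 0 ≤ g / 2 := by linarith
  refine (measure_ge_le_exp_mul_mgf (t := g / 2) t hl .of_finite).trans ?_
  have hprod : mgf (fun ω => ∑ c ∈ F, Y c ω) μ (g / 2) =
      ∏ c ∈ F, ∫ ω, Real.exp (g / 2 * Y c ω) ∂μ := by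
    rw [← integral_prod_of_dependsOnBits hB hT
      (fun c hc => (hYT c hc).comp (fun y => Real.exp (g / 2 * y)))]
    simp only [mgf, Finset.mul_sum, Real.exp_sum]
  have hle : ∏ c ∈ F, ∫ ω, Real.exp (g / 2 * Y c ω) ∂μ ≤
      ∏ c ∈ F, Real.exp (-(g ^ 2 * v / 4)) := by
    refine Finset.prod_le_prod (fun c _ => integral_nonneg fun ω => (Real.exp_pos _).le)
      fun c hc => ?_
    refine (integral_exp_mul_le hl (fun ω => ?_) (h1 c hc) (h2 c hc)).trans_eq ?_
    · rw [abs_mul, abs_of_nonneg hl]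
      nlinarith [hY c hc ω, abs_nonneg (Y c ω)]
    · congr 1; ring
  rw [hprod]
  refine (mul_le_mul_of_nonneg_left hle (Real.exp_pos _).le).trans_eq ?_
  rw [Finset.prod_const, ← Real.exp_nat_mul, ← Real.exp_add]
  congr 1; ring

end Chernoff

/-! ### Colouring a partial injection -/

/-- A partial injection without fixed points, given as the map `e c ↦ e' c`, can be coloured with
three colours in such a way that within a colour class no source is a target. -/
theorem exists_three_colouring {κ α : Type*} (F : Finset κ) {e e' : κ → α}
    (he : Set.InjOn e F) (he' : Set.InjOn e' F) (hne : ∀ c ∈ F, e c ≠ e' c) :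
    ∃ col : κ → Fin 3, ∀ c ∈ F, ∀ c' ∈ F, e c = e' c' → col c ≠ col c' := by
  classical
  induction F using Finset.induction_on with
  | empty => exact ⟨fun _ => 0, by simp⟩
  | insert a F ha ih =>
    obtain ⟨col, hcol⟩ := ih (he.mono (by simp)) (he'.mono (by simp))
      (fun c hc => hne c (by simp [hc]))
    -- At most one element of `F` has `e c = e' a` and at most one has `e' c = e a`.
    have h1 : ∃ k : Fin 3, ∀ c ∈ F, e a = e' c → col c = k := by
      by_cases h : ∃ c ∈ F, e a = e' c
      · obtain ⟨c, hc, hac⟩ := h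
        refine ⟨col c, fun c' hc' hac' => ?_⟩
        rw [he' (by simp [hc']) (by simp [hc]) (hac'.symm.trans hac)]
      · exact ⟨0, fun c hc hac => (h ⟨c, hc, hac⟩).elim⟩
    have h2 : ∃ k : Fin 3, ∀ c ∈ F, e c = e' a → col c = k := by
      by_cases h : ∃ c ∈ F, e c = e' a
      · obtain ⟨c, hc, hac⟩ := h
        refine ⟨col c, fun c' hc' hac' => ?_⟩
        rw [he (by simp [hc']) (by simp [hc]) (hac'.trans hac.symm)]
      · exact ⟨0, fun c hc hac => (h ⟨c, hc, hac⟩).elim⟩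
    obtain ⟨k1, hk1⟩ := h1
    obtain ⟨k2, hk2⟩ := h2
    obtain ⟨k, hk⟩ : ∃ k : Fin 3, k ≠ k1 ∧ k ≠ k2 := by
      have hk : ∀ k1 k2 : Fin 3, ∃ k : Fin 3, k ≠ k1 ∧ k ≠ k2 := by decide
      exact hk k1 k2
    refine ⟨Function.update col a k, fun c hc c' hc' hcc' => ?_⟩
    rcases Finset.mem_insert.1 hc with rfl | hcF <;>
      rcases Finset.mem_insert.1 hc' with rfl | hcF'
    · exact (hne _ (by simp) hcc').elim
    · have : c' ≠ c := fun h => ha (h ▸ hcF')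
      simp only [Function.update_self, Function.update_of_ne this]
      rw [hk1 c' hcF' hcc']; exact hk.1
    · have : c ≠ c' := fun h => ha (h ▸ hcF)
      simp only [Function.update_self, Function.update_of_ne this]
      rw [hk2 c hcF hcc']; exact hk.2.symm
    · have h : c ≠ a := fun h => ha (h ▸ hcF)
      have h' : c' ≠ a := fun h => ha (h ▸ hcF')
      simp only [Function.update_of_ne h, Function.update_of_ne h']
      exact hcol c hcF c' hcF' hcc'

/-! ### Concentration for pairs of noisy observations -/

section Model

variable {n m : ℕ} {pv q : unitInterval}
  {op : SimpleGraph (Fin n) → SimpleGraph (Fin n) → SimpleGraph (Fin n)} {r γ : ℝ}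

/-- The noisy version of the whole graph whose restriction to the sampled vertices is the `i`-th
trace. The operation `op` combines the graph with the marked pairs. -/
def noisyGraph (op : SimpleGraph (Fin n) → SimpleGraph (Fin n) → SimpleGraph (Fin n))
    (x : NoiseSpace n m) (i : Fin m) : SimpleGraph (Fin n) := op x.1 (x.2 i).2

/-- The operation `op` treats all pairs of vertices separately; in a noisy graph each pair is an
edge with probability `r`, and in two noisy graphs simultaneously with probability `r ^ 2 + γ`. -/
structure IsNoiseModel (n m : ℕ) (pv q : unitInterval)
    (op : SimpleGraph (Fin n) → SimpleGraph (Fin n) → SimpleGraph (Fin n)) (r γ : ℝ) : Prop where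
  edge_congr : ∀ (G K G' K' : SimpleGraph (Fin n)) (e : Sym2 (Fin n)),
    (e ∈ G.edgeSet ↔ e ∈ G'.edgeSet) → (e ∈ K.edgeSet ↔ e ∈ K'.edgeSet) →
    (e ∈ (op G K).edgeSet ↔ e ∈ (op G' K').edgeSet)
  prob_edge : ∀ (i : Fin m) (e : Sym2 (Fin n)), ¬ e.IsDiag →
    (graphAndNoise n m pv q).real {x | e ∈ (noisyGraph op x i).edgeSet} = r
  prob_both : ∀ (i j : Fin m), i ≠ j → ∀ e : Sym2 (Fin n), ¬ e.IsDiag →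
    (graphAndNoise n m pv q).real
      {x | e ∈ (noisyGraph op x i).edgeSet ∧ e ∈ (noisyGraph op x j).edgeSet} = r ^ 2 + γ

/-- The indicator that `e` is an edge of the `i`-th noisy graph and `e'` one of the `j`-th. -/
noncomputable def bothEdges (op : SimpleGraph (Fin n) → SimpleGraph (Fin n) → SimpleGraph (Fin n))
    (i j : Fin m) (e e' : Sym2 (Fin n)) (x : NoiseSpace n m) : ℝ :=
  ind (e ∈ (noisyGraph op x i).edgeSet ∧ e' ∈ (noisyGraph op x j).edgeSet)

/-- The indicator that the vertex `z` is sampled in both the `i`-th and the `j`-th trace. -/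
noncomputable def bothSampled (i j : Fin m) (z : Fin n) (x : NoiseSpace n m) : ℝ :=
  ind (z ∈ (x.2 i).1 ∧ z ∈ (x.2 j).1)

/-- The bits that determine the states of the pairs `e` and `e'` in the traces `i` and `j`. -/
def edgeBlock (i j : Fin m) (e e' : Sym2 (Fin n)) : Finset (BitIndex n m) :=
  {.inl e, .inl e', .inr (i, .inr e), .inr (j, .inr e')}

/-- The bits that determine whether the vertex `z` is sampled in the traces `i` and `j`. -/
def vertexBlock (i j : Fin m) (z : Fin n) : Finset (BitIndex n m) :=
  {.inr (i, .inl z), .inr (j, .inl z)}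

theorem disjoint_edgeBlock {i j : Fin m} {e₁ e₁' e₂ e₂' : Sym2 (Fin n)} (h1 : e₁ ≠ e₂)
    (h2 : e₁ ≠ e₂') (h3 : e₁' ≠ e₂) (h4 : e₁' ≠ e₂') :
    Disjoint (edgeBlock i j e₁ e₁') (edgeBlock i j e₂ e₂') := by
  rw [Finset.disjoint_left]
  intro t ht ht'
  simp only [edgeBlock, Finset.mem_insert, Finset.mem_singleton] at ht ht'
  grind

theorem disjoint_vertexBlock {i j : Fin m} {z z' : Fin n} (h : z ≠ z') :
    Disjoint (vertexBlock i j z) (vertexBlock i j z') := by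
  rw [Finset.disjoint_left]
  intro t ht ht'
  simp only [vertexBlock, Finset.mem_insert, Finset.mem_singleton] at ht ht'
  grind

theorem disjoint_vertexBlock_edgeBlock {i j : Fin m} {z : Fin n} {e e' : Sym2 (Fin n)} :
    Disjoint (vertexBlock i j z) (edgeBlock i j e e') := by
  rw [Finset.disjoint_left]
  intro t ht ht'
  simp only [vertexBlock, edgeBlock, Finset.mem_insert, Finset.mem_singleton] at ht ht'
  grind

theorem dependsOnBits_bothSampled (i j : Fin m) (z : Fin n) :
    DependsOnBits noiseBit (vertexBlock i j z) (bothSampled i j z) := by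
  intro x y h
  have h1 : z ∈ (x.2 i).1 ↔ z ∈ (y.2 i).1 := h (.inr (i, .inl z)) (by simp [vertexBlock])
  have h2 : z ∈ (x.2 j).1 ↔ z ∈ (y.2 j).1 := h (.inr (j, .inl z)) (by simp [vertexBlock])
  simp only [bothSampled, h1, h2]

theorem integral_bothSampled {i j : Fin m} (hij : i ≠ j) (z : Fin n) :
    ∫ x, bothSampled i j z x ∂(graphAndNoise n m pv q) = (pv : ℝ) ^ 2 := by
  have hd : ∀ i : Fin m, DependsOnBits noiseBit ({.inr (i, .inl z)} : Finset (BitIndex n m))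
      (fun x => ind (z ∈ (x.2 i).1)) := by
    intro i x y h
    have h1 : z ∈ (x.2 i).1 ↔ z ∈ (y.2 i).1 := h (.inr (i, .inl z)) (by simp)
    simp only [h1]
  simp only [bothSampled, ind_and]
  rw [integral_mul_of_dependsOnBits (iIndepFun_noiseBit n m pv q) ?_ (hd i) (hd j), integral_ind,
    integral_ind, sq]
  · exact congrArg₂ _ (graphAndNoise_real_vertex pv q i z) (graphAndNoise_real_vertex pv q j z)
  · simpa using hij

/-- The sum over the commonly sampled vertices of bounded variables of mean at most `-g` that depend
on disjoint sets of pairs is rarely nonnegative. -/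
theorem measureReal_zero_le_sum_bothSampled_mul_le {i j : Fin m} (hij : i ≠ j) {F : Finset (Fin n)}
    {e e' : Fin n → Sym2 (Fin n)}
    (hd : ∀ z ∈ F, ∀ z' ∈ F, z ≠ z' → e z ≠ e z' ∧ e z ≠ e' z' ∧ e' z ≠ e z' ∧ e' z ≠ e' z')
    {W : Fin n → NoiseSpace n m → ℝ}
    (hW : ∀ z ∈ F, DependsOnBits noiseBit (edgeBlock i j (e z) (e' z)) (W z))
    (hW1 : ∀ z ∈ F, ∀ x, |W z x| ≤ 1) {g : ℝ} (hg : 0 ≤ g) (hg1 : g ≤ 1)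
    (hWi : ∀ z ∈ F, ∫ x, W z x ∂(graphAndNoise n m pv q) ≤ -g) :
    (graphAndNoise n m pv q).real {x | 0 ≤ ∑ z ∈ F, bothSampled i j z x * W z x} ≤
      Real.exp (-(F.card * (g ^ 2 * (pv : ℝ) ^ 2 / 4))) := by
  have hB := iIndepFun_noiseBit n m pv q
  have hi : ∀ f : NoiseSpace n m → ℝ, Integrable f (graphAndNoise n m pv q) := fun f => .of_finite
  have hs0 : ∀ (z : Fin n) (x : NoiseSpace n m), 0 ≤ bothSampled i j z x := fun _ _ => ind_nonneg
  have hs1 : ∀ (z : Fin n) (x : NoiseSpace n m), bothSampled i j z x ≤ 1 := fun _ _ => ind_le_one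
  have hmul : ∀ z ∈ F, ∫ x, bothSampled i j z x * W z x ∂(graphAndNoise n m pv q) =
      (pv : ℝ) ^ 2 * ∫ x, W z x ∂(graphAndNoise n m pv q) := by
    intro z hz
    rw [integral_mul_of_dependsOnBits hB disjoint_vertexBlock_edgeBlock
      (dependsOnBits_bothSampled i j z) (hW z hz), integral_bothSampled hij]
  have key := measureReal_le_sum_le_exp (μ := graphAndNoise n m pv q) hB (F := F)
    (T := fun z => vertexBlock i j z ∪ edgeBlock i j (e z) (e' z))
    (Y := fun z x => bothSampled i j z x * W z x) (g := g) (v := (pv : ℝ) ^ 2)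
    ?_ ?_ hg hg1 ?_ ?_ ?_ 0
  · refine key.trans_eq ?_
    congr 1; ring
  · intro z hz z' hz' hzz'
    obtain ⟨h1, h2, h3, h4⟩ := hd z hz z' hz' hzz'
    simp only [Function.onFun, Finset.disjoint_union_left, Finset.disjoint_union_right]
    exact ⟨⟨disjoint_vertexBlock hzz', disjoint_vertexBlock_edgeBlock.symm⟩,
      disjoint_vertexBlock_edgeBlock, disjoint_edgeBlock h1 h2 h3 h4⟩
  · intro z hz x y h
    simp only [dependsOnBits_bothSampled i j z x y fun t ht => h t (Finset.mem_union_left _ ht),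
      hW z hz x y fun t ht => h t (Finset.mem_union_right _ ht)]
  · intro z hz x
    rw [abs_mul, abs_of_nonneg (hs0 z x)]
    nlinarith [hs0 z x, hs1 z x, hW1 z hz x, abs_nonneg (W z x)]
  · intro z hz
    rw [hmul z hz]
    nlinarith [hWi z hz, sq_nonneg (pv : ℝ)]
  · intro z hz
    rw [← integral_bothSampled (pv := pv) (q := q) hij z]
    refine integral_mono (hi _) (hi _) fun x => ?_
    have hsq : bothSampled i j z x ^ 2 = bothSampled i j z x := ind_sq
    have : W z x ^ 2 ≤ 1 := (sq_le_one_iff_abs_le_one _).2 (hW1 z hz x)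
    simp only [mul_pow, hsq]
    nlinarith [hs0 z x]

/-- The number of commonly sampled vertices is close to its mean `pv ^ 2 * n`; the sign `ε` selects
the upper or the lower tail. -/
theorem measureReal_card_bothSampled_deviation_le {i j : Fin m} (hij : i ≠ j) {δ ε : ℝ}
    (hδ : 0 ≤ δ) (hδ1 : δ ≤ 1) (hε : ε ^ 2 = 1) :
    (graphAndNoise n m pv q).real
      {x | δ * ((pv : ℝ) ^ 2 * n) ≤ ε * (∑ z, bothSampled i j z x - (pv : ℝ) ^ 2 * n)} ≤
      Real.exp (-(n * (δ ^ 2 * (pv : ℝ) ^ 2 / 4))) := by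
  have hB := iIndepFun_noiseBit n m pv q
  have hi : ∀ f : NoiseSpace n m → ℝ, Integrable f (graphAndNoise n m pv q) := fun f => .of_finite
  have hp0 : 0 ≤ (pv : ℝ) ^ 2 := sq_nonneg _
  have hp1 : (pv : ℝ) ^ 2 ≤ 1 := pow_le_one₀ pv.2.1 pv.2.2
  have key := measureReal_le_sum_le_exp (μ := graphAndNoise n m pv q) hB (F := Finset.univ)
    (T := fun z => vertexBlock i j z)
    (Y := fun z x => ε * (bothSampled i j z x - (pv : ℝ) ^ 2) - δ * (pv : ℝ) ^ 2) (g := δ)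
    (v := (pv : ℝ) ^ 2) ?_ ?_ hδ hδ1 ?_ ?_ ?_ 0
  · simp only [Finset.sum_sub_distrib, ← Finset.mul_sum, Finset.sum_const, Finset.card_univ,
      Fintype.card_fin, nsmul_eq_mul, sub_nonneg] at key
    refine (le_of_eq ?_).trans (key.trans_eq ?_)
    · congr 1; ext x; simp only [Set.mem_ofPred_eq]; ring_nf
    · congr 1; ring
  · intro z _ z' _ hzz'
    exact disjoint_vertexBlock hzz'
  · intro z _
    exact (dependsOnBits_bothSampled i j z).comp
      (fun s => ε * (s - (pv : ℝ) ^ 2) - δ * (pv : ℝ) ^ 2)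
  · intro z _ x
    have h0 : 0 ≤ bothSampled i j z x := ind_nonneg
    have h1 : bothSampled i j z x ≤ 1 := ind_le_one
    rw [abs_le]
    rcases sq_eq_one_iff.1 hε with rfl | rfl <;> constructor <;> nlinarith
  · intro z _
    rw [integral_sub (hi _) (hi _), integral_const_mul, integral_sub (hi _) (hi _),
      integral_bothSampled hij]
    simp
  · intro z _
    have : ∀ x, (ε * (bothSampled i j z x - (pv : ℝ) ^ 2) - δ * (pv : ℝ) ^ 2) ^ 2 =
        (1 - 2 * (pv : ℝ) ^ 2 - 2 * ε * δ * (pv : ℝ) ^ 2) * bothSampled i j z x +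
          (((pv : ℝ) ^ 2) ^ 2 + 2 * ε * δ * ((pv : ℝ) ^ 2) ^ 2 + (δ * (pv : ℝ) ^ 2) ^ 2) := by
      intro x
      have hsq : bothSampled i j z x ^ 2 = bothSampled i j z x := ind_sq
      linear_combination hsq + (bothSampled i j z x - (pv : ℝ) ^ 2) ^ 2 * hε
    simp only [this]
    rw [integral_add (hi _) (hi _), integral_const_mul, integral_bothSampled hij]
    simp only [integral_const, probReal_univ, one_smul]
    nlinarith [mul_nonneg hp0 hp0, mul_nonneg (mul_nonneg hp0 hp0)
      (sub_nonneg.2 (pow_le_one₀ hδ hδ1 : δ ^ 2 ≤ 1))]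

namespace IsNoiseModel

variable (M : IsNoiseModel n m pv q op r γ)

include M

theorem dependsOnBits_edge (i : Fin m) (e : Sym2 (Fin n)) :
    DependsOnBits noiseBit ({.inl e, .inr (i, .inr e)} : Finset (BitIndex n m))
      (fun x => e ∈ (noisyGraph op x i).edgeSet) := by
  intro x y h
  exact propext (M.edge_congr _ _ _ _ e (h (.inl e) (by simp)) (h (.inr (i, .inr e)) (by simp)))

theorem dependsOnBits_bothEdges (i j : Fin m) (e e' : Sym2 (Fin n)) :
    DependsOnBits noiseBit (edgeBlock i j e e') (bothEdges op i j e e') := by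
  intro x y h
  have h1 := M.dependsOnBits_edge i e x y fun t ht => h t (by simp [edgeBlock] at ht ⊢; grind)
  have h2 := M.dependsOnBits_edge j e' x y fun t ht => h t (by simp [edgeBlock] at ht ⊢; grind)
  simp only at h1 h2
  simp only [bothEdges, h1, h2]

theorem integral_bothEdges_self {i j : Fin m} (hij : i ≠ j) {e : Sym2 (Fin n)}
    (he : ¬ e.IsDiag) :
    ∫ x, bothEdges op i j e e x ∂(graphAndNoise n m pv q) = r ^ 2 + γ := by
  simp only [bothEdges]
  rw [integral_ind, M.prob_both i j hij e he]

theorem integral_bothEdges_of_ne (i j : Fin m) {e e' : Sym2 (Fin n)} (hee' : e ≠ e')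
    (he : ¬ e.IsDiag) (he' : ¬ e'.IsDiag) :
    ∫ x, bothEdges op i j e e' x ∂(graphAndNoise n m pv q) = r ^ 2 := by
  simp only [bothEdges, ind_and]
  rw [integral_mul_of_dependsOnBits (iIndepFun_noiseBit n m pv q) ?_
    ((M.dependsOnBits_edge i e).comp ind) ((M.dependsOnBits_edge j e').comp ind), integral_ind,
    integral_ind, M.prob_edge i e he, M.prob_edge j e' he', sq]
  rw [Finset.disjoint_left]
  intro t ht ht'
  simp only [Finset.mem_insert, Finset.mem_singleton] at ht ht'
  grind

/-- With the identity alignment, the number of common neighbours of a vertex in the common part of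
two traces is rarely below its mean by a noticeable amount. -/
theorem measureReal_few_true_agreements_le {i j : Fin m} (hij : i ≠ j) (hγ : 0 ≤ γ)
    (hr1 : r ^ 2 + γ ≤ 1) (u : Fin n) :
    (graphAndNoise n m pv q).real
      {x | 0 ≤ ∑ z ∈ Finset.univ.erase u, bothSampled i j z x *
        ((r ^ 2 + 3 * γ / 4) - bothEdges op i j s(u, z) s(u, z) x)} ≤
      Real.exp (-(((n : ℝ) - 1) * ((γ / 4) ^ 2 * (pv : ℝ) ^ 2 / 4))) := by
  have hr0 : 0 ≤ r ^ 2 := sq_nonneg r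
  have hi : ∀ f : NoiseSpace n m → ℝ, Integrable f (graphAndNoise n m pv q) := fun f => .of_finite
  refine (measureReal_zero_le_sum_bothSampled_mul_le hij (e := fun z => s(u, z))
    (e' := fun z => s(u, z)) (g := γ / 4) ?_ ?_ ?_ (by linarith) (by linarith) ?_).trans_eq ?_
  · intro z hz z' hz' hzz'
    simp only [ne_eq, Sym2.eq_iff, Finset.mem_erase] at *
    grind
  · exact fun z _ => (M.dependsOnBits_bothEdges i j _ _).comp (fun a => (r ^ 2 + 3 * γ / 4) - a)
  · intro z _ x
    have h0 : 0 ≤ bothEdges op i j s(u, z) s(u, z) x := ind_nonneg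
    have h1 : bothEdges op i j s(u, z) s(u, z) x ≤ 1 := ind_le_one
    rw [abs_le]
    constructor <;> linarith
  · intro z hz
    have hz' : u ≠ z := (Finset.ne_of_mem_erase hz).symm
    rw [integral_sub (hi _) (hi _), M.integral_bothEdges_self hij (by simpa using hz')]
    simp only [integral_const, probReal_univ, one_smul]
    linarith
  · have hn : 1 ≤ n := Nat.one_le_of_lt u.2
    rw [Finset.card_erase_of_mem (Finset.mem_univ _), Finset.card_univ, Fintype.card_fin,
      Nat.cast_sub hn, Nat.cast_one]

/-- Two different vertices rarely have noticeably more common neighbours in the common part of two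
traces than the mean. -/
theorem measureReal_many_false_agreements_le {i j : Fin m} (hij : i ≠ j) (hγ : 0 ≤ γ)
    (hr1 : r ^ 2 + γ ≤ 1) {u w : Fin n} (huw : u ≠ w) :
    (graphAndNoise n m pv q).real
      {x | 0 ≤ ∑ z ∈ (Finset.univ.erase u).erase w, bothSampled i j z x *
        (bothEdges op i j s(u, z) s(w, z) x - (r ^ 2 + γ / 4))} ≤
      Real.exp (-(((n : ℝ) - 2) * ((γ / 4) ^ 2 * (pv : ℝ) ^ 2 / 4))) := by
  have hr0 : 0 ≤ r ^ 2 := sq_nonneg r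
  have hi : ∀ f : NoiseSpace n m → ℝ, Integrable f (graphAndNoise n m pv q) := fun f => .of_finite
  refine (measureReal_zero_le_sum_bothSampled_mul_le hij (e := fun z => s(u, z))
    (e' := fun z => s(w, z)) (g := γ / 4) ?_ ?_ ?_ (by linarith) (by linarith) ?_).trans_eq ?_
  · intro z hz z' hz' hzz'
    simp only [ne_eq, Sym2.eq_iff, Finset.mem_erase] at *
    grind
  · exact fun z _ => (M.dependsOnBits_bothEdges i j _ _).comp (fun a => a - (r ^ 2 + γ / 4))
  · intro z _ x
    have h0 : 0 ≤ bothEdges op i j s(u, z) s(w, z) x := ind_nonneg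
    have h1 : bothEdges op i j s(u, z) s(w, z) x ≤ 1 := ind_le_one
    rw [abs_le]
    constructor <;> linarith
  · intro z hz
    simp only [Finset.mem_erase, Finset.mem_univ, and_true] at hz
    rw [integral_sub (hi _) (hi _), M.integral_bothEdges_of_ne i j]
    · simp only [integral_const, probReal_univ, one_smul]
      linarith
    · simp only [ne_eq, Sym2.eq_iff]
      grind
    · simpa using fun h => hz.2 h.symm
    · simpa using fun h => hz.1 h.symm
  · have hn : 2 ≤ n := by
      have := u.2; have := w.2
      by_contra h
      exact huw (Fin.ext (by omega))
    rw [Finset.card_erase_of_mem (by simp [huw.symm]), Finset.card_erase_of_mem (Finset.mem_univ _),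
      Finset.card_univ, Fintype.card_fin, Nat.sub_sub, Nat.cast_sub hn]
    norm_num

/-- Along a fixed-point free partial injection of pairs, the number of pairs that are edges on both
sides rarely exceeds its mean by a noticeable amount. -/
theorem measureReal_sum_bothEdges_le {κ : Type*} {i j : Fin m} (hγ : 0 ≤ γ)
    (hr1 : r ^ 2 + γ ≤ 1) {F : Finset κ} {e e' : κ → Sym2 (Fin n)}
    (he : Set.InjOn e F) (he' : Set.InjOn e' F) (hne : ∀ c ∈ F, e c ≠ e' c)
    (hd : ∀ c ∈ F, ¬ (e c).IsDiag) (hd' : ∀ c ∈ F, ¬ (e' c).IsDiag) (t : ℝ) :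
    (graphAndNoise n m pv q).real
      {x | t ≤ ∑ c ∈ F, (bothEdges op i j (e c) (e' c) x - (r ^ 2 + γ / 4))} ≤
      3 * Real.exp (-(γ * t / 24)) := by
  classical
  have hr0 : 0 ≤ r ^ 2 := sq_nonneg r
  have hB := iIndepFun_noiseBit n m pv q
  have hi : ∀ f : NoiseSpace n m → ℝ, Integrable f (graphAndNoise n m pv q) := fun f => .of_finite
  obtain ⟨col, hcol⟩ := exists_three_colouring F he he' hne
  -- Within one colour class the terms are independent.
  have hclass : ∀ k : Fin 3, (graphAndNoise n m pv q).real
      {x | t / 3 ≤ ∑ c ∈ F with col c = k,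
        (bothEdges op i j (e c) (e' c) x - (r ^ 2 + γ / 4))} ≤ Real.exp (-(γ * t / 24)) := by
    intro k
    have key := measureReal_le_sum_le_exp (μ := graphAndNoise n m pv q) hB
      (F := F.filter (fun c => col c = k)) (T := fun c => edgeBlock i j (e c) (e' c))
      (Y := fun c x => bothEdges op i j (e c) (e' c) x - (r ^ 2 + γ / 4)) (g := γ / 4) (v := 1)
      ?_ ?_ (by linarith) (by linarith) ?_ ?_ ?_ (t / 3)
    · refine key.trans (Real.exp_le_exp.2 ?_)
      have : 0 ≤ ((F.filter (fun c => col c = k)).card : ℝ) * ((γ / 4) ^ 2 * 1 / 4) := by positivity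
      linarith
    · intro c hc c' hc' hcc'
      simp only [Finset.coe_filter, Set.mem_ofPred_eq] at hc hc'
      refine disjoint_edgeBlock (fun h => hcc' (he hc.1 hc'.1 h)) (fun h => ?_) (fun h => ?_)
        (fun h => hcc' (he' hc.1 hc'.1 h))
      · exact hcol c hc.1 c' hc'.1 h (hc.2.trans hc'.2.symm)
      · exact hcol c' hc'.1 c hc.1 h.symm (hc'.2.trans hc.2.symm)
    · exact fun c _ => (M.dependsOnBits_bothEdges i j _ _).comp (fun a => a - (r ^ 2 + γ / 4))
    · intro c _ x
      have h0 : 0 ≤ bothEdges op i j (e c) (e' c) x := ind_nonneg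
      have h1 : bothEdges op i j (e c) (e' c) x ≤ 1 := ind_le_one
      rw [abs_le]
      constructor <;> linarith
    · intro c hc
      have hc := (Finset.mem_filter.1 hc).1
      rw [integral_sub (hi _) (hi _),
        M.integral_bothEdges_of_ne i j (hne c hc) (hd c hc) (hd' c hc)]
      simp only [integral_const, probReal_univ, one_smul]
      linarith
    · intro c hc
      refine (integral_mono (hi _) (hi (fun _ => 1)) fun x => ?_).trans_eq (by simp)
      have h0 : 0 ≤ bothEdges op i j (e c) (e' c) x := ind_nonneg
      have h1 : bothEdges op i j (e c) (e' c) x ≤ 1 := ind_le_one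
      simp only [sq_le_one_iff_abs_le_one, abs_le]
      constructor <;> linarith
  calc _ ≤ (graphAndNoise n m pv q).real (⋃ k ∈ (Finset.univ : Finset (Fin 3)),
        {x | t / 3 ≤ ∑ c ∈ F with col c = k,
          (bothEdges op i j (e c) (e' c) x - (r ^ 2 + γ / 4))}) := by
        refine measureReal_mono (fun x hx => ?_) (measure_ne_top _ _)
        simp only [Finset.mem_univ, Set.iUnion_true, Set.mem_iUnion, Set.mem_ofPred_eq] at hx ⊢
        by_contra! h
        rw [← Finset.sum_fiberwise F col, Fin.sum_univ_three] at hx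
        linarith [h 0, h 1, h 2]
    _ ≤ ∑ k : Fin 3, Real.exp (-(γ * t / 24)) :=
        (measureReal_biUnion_finset_le _ _).trans (Finset.sum_le_sum fun k _ => hclass k)
    _ = _ := by simp

end IsNoiseModel

end Model

/-! ### Aligning the vertices of two traces -/

section Alignment

variable {n m : ℕ} {op : SimpleGraph (Fin n) → SimpleGraph (Fin n) → SimpleGraph (Fin n)}

/-- The `i`-th labelled trace: the noisy graph induced on the sampled vertices. -/
def noisyTrace (op : SimpleGraph (Fin n) → SimpleGraph (Fin n) → SimpleGraph (Fin n))
    (x : NoiseSpace n m) (i : Fin m) : LabelledTrace n :=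
  ⟨(x.2 i).1, (noisyGraph op x i).induce (x.2 i).1⟩

/-- The vertices `u` and `w` of two traces are matched by a partial injection between the traces
that is defined on at least `s` vertices, and such that each of the matched vertices has, for at
least the fraction `τ` of the matched vertices, an edge to them in both traces. This notion does
not refer to the labels of the vertices. -/
def Aligned (s τ : ℝ) (T T' : LabelledTrace n) (u : T.1) (w : T'.1) : Prop :=
  ∃ (K : ℕ) (a : Fin K → T.1) (b : Fin K → T'.1), s ≤ K ∧ Function.Injective a ∧
    Function.Injective b ∧ (∃ l, a l = u ∧ b l = w) ∧
    ∀ l, τ * K ≤ ∑ l', ind (T.2.Adj (a l) (a l') ∧ T'.2.Adj (b l) (b l'))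

theorem Aligned.map {s τ : ℝ} {T T' T₁ T₁' : LabelledTrace n} (φ : T.2 ≃g T₁.2)
    (ψ : T'.2 ≃g T₁'.2) {u : T.1} {w : T'.1} (h : Aligned s τ T T' u w) :
    Aligned s τ T₁ T₁' (φ u) (ψ w) := by
  obtain ⟨K, a, b, hK, ha, hb, ⟨l, hu, hw⟩, hdeg⟩ := h
  refine ⟨K, fun l => φ (a l), fun l => ψ (b l), hK, φ.injective.comp ha, ψ.injective.comp hb,
    ⟨l, congrArg φ hu, congrArg ψ hw⟩, fun l => ?_⟩
  simpa only [SimpleGraph.Iso.map_adj_iff] using hdeg l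

/-- In the traces `i` and `j`, alignment detects exactly the equality of labels. -/
def AlignsCorrectly (op : SimpleGraph (Fin n) → SimpleGraph (Fin n) → SimpleGraph (Fin n))
    (s τ : ℝ) (x : NoiseSpace n m) (i j : Fin m) : Prop :=
  ∀ u w, Aligned s τ (noisyTrace op x i) (noisyTrace op x j) u w ↔ u.1 = w.1

/-- The number of traces in `J` that contain both `u` and `v`. -/
noncomputable def seenCount (J : Finset (Fin m)) (x : NoiseSpace n m) (u v : Fin n) : ℝ :=
  ∑ i ∈ J, ind (u ∈ (x.2 i).1 ∧ v ∈ (x.2 i).1)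

/-- The number of traces in `J` in which `u` and `v` are present and adjacent. -/
noncomputable def edgeCount (op : SimpleGraph (Fin n) → SimpleGraph (Fin n) → SimpleGraph (Fin n))
    (J : Finset (Fin m)) (x : NoiseSpace n m) (u v : Fin n) : ℝ :=
  ∑ i ∈ J, ind (u ∈ (x.2 i).1 ∧ v ∈ (x.2 i).1 ∧ (noisyGraph op x i).Adj u v)

/-- An outcome is decodable from the traces in `J` with the decision rule `dec` if the traces can be
aligned and the rule finds the edges from the numbers of observations. -/
def Decodable (op : SimpleGraph (Fin n) → SimpleGraph (Fin n) → SimpleGraph (Fin n)) (s τ : ℝ)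
    (J : Finset (Fin m)) (dec : ℝ → ℝ → Prop) (x : NoiseSpace n m) : Prop :=
  (∀ i ∈ J, ∀ j ∈ J, i ≠ j → AlignsCorrectly op s τ x i j) ∧
    ∀ u v, u ≠ v → (x.1.Adj u v ↔ dec (seenCount J x u v) (edgeCount op J x u v))

/-- A decodable outcome is determined up to isomorphism by its unlabelled traces: isomorphisms
between the traces of two decodable outcomes respect the alignment, so they glue. -/
theorem Decodable.nonempty_iso {s τ : ℝ} {J : Finset (Fin m)} {dec : ℝ → ℝ → Prop}
    {x y : NoiseSpace n m} (hx : Decodable op s τ J dec x) (hy : Decodable op s τ J dec y)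
    (h : ∀ i, Nonempty ((noisyTrace op x i).2 ≃g (noisyTrace op y i).2)) :
    Nonempty (x.1 ≃g y.1) := by
  classical
  let φ := fun i => (h i).some
  let R : Fin n → Fin n → Prop := fun u u' =>
    ∃ i ∈ J, ∃ hu : u ∈ (x.2 i).1, (φ i ⟨u, hu⟩).1 = u'
  have hR : ∀ u u' w w', R u u' → R w w' → (u = w ↔ u' = w') := by
    rintro u u' w w' ⟨i, hi, hu, rfl⟩ ⟨j, hj, hw, rfl⟩
    by_cases hij : i = j
    · subst hij
      refine ⟨fun h => by subst h; rfl, fun h => ?_⟩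
      exact congrArg Subtype.val ((φ i).injective (Subtype.ext h))
    · rw [← hy.1 i hi j hj hij (φ i ⟨u, hu⟩) (φ j ⟨w, hw⟩)]
      refine (hx.1 i hi j hj hij ⟨u, hu⟩ ⟨w, hw⟩).symm.trans ⟨Aligned.map (φ i) (φ j), fun h => ?_⟩
      simpa using h.map (φ i).symm (φ j).symm
  let U : Fin n → Prop := fun u => ∃ i ∈ J, u ∈ (x.2 i).1
  have hU : ∀ u : {u // U u}, ∃ u', R u u' := fun ⟨u, i, hi, hu⟩ => ⟨_, i, hi, hu, rfl⟩
  choose f hf using hU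
  have hinj : Function.Injective f := fun u w huw => Subtype.ext ((hR _ _ _ _ (hf u) (hf w)).2 huw)
  let σ : Equiv.Perm (Fin n) :=
    Equiv.extendSubtype (q := fun v => v ∈ Set.range f) (Equiv.ofInjective f hinj)
  have hσ : ∀ u, U u → R u (σ u) := by
    intro u hu
    have : σ u = f ⟨u, hu⟩ := Equiv.extendSubtype_apply_of_mem _ u hu
    rw [this]
    exact hf ⟨u, hu⟩
  have hσφ : ∀ i ∈ J, ∀ u (hu : u ∈ (x.2 i).1), (φ i ⟨u, hu⟩).1 = σ u := fun i hi u hu =>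
    (hR u _ u _ ⟨i, hi, hu, rfl⟩ (hσ u ⟨i, hi, hu⟩)).1 rfl
  have hmem : ∀ i ∈ J, ∀ u, u ∈ (x.2 i).1 ↔ σ u ∈ (y.2 i).1 := by
    intro i hi u
    constructor
    · intro hu
      rw [← hσφ i hi u hu]
      exact (φ i ⟨u, hu⟩).2
    · intro hu
      obtain ⟨⟨w, hw⟩, hwu⟩ := (φ i).surjective ⟨σ u, hu⟩
      have h1 := hσφ i hi w hw
      rw [hwu] at h1
      rwa [σ.injective h1]
  have hadj : ∀ i ∈ J, ∀ u v, (u ∈ (x.2 i).1 ∧ v ∈ (x.2 i).1 ∧ (noisyGraph op x i).Adj u v) ↔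
      (σ u ∈ (y.2 i).1 ∧ σ v ∈ (y.2 i).1 ∧ (noisyGraph op y i).Adj (σ u) (σ v)) := by
    intro i hi u v
    rw [← hmem i hi u, ← hmem i hi v]
    refine and_congr_right fun hu => and_congr_right fun hv => ?_
    have := (φ i).map_adj_iff (v := ⟨u, hu⟩) (w := ⟨v, hv⟩)
    simp only [noisyTrace, SimpleGraph.comap_adj, Function.Embedding.subtype_apply] at this
    rw [← hσφ i hi u hu, ← hσφ i hi v hv]
    exact this.symm
  refine ⟨⟨σ, fun {u v} => ?_⟩⟩
  by_cases huv : u = v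
  · simp [huv]
  · rw [hx.2 u v huv, hy.2 (σ u) (σ v) (fun h => huv (σ.injective h))]
    have h1 : seenCount J y (σ u) (σ v) = seenCount J x u v :=
      Finset.sum_congr rfl fun i hi => by rw [hmem i hi u, hmem i hi v]
    have h2 : edgeCount op J y (σ u) (σ v) = edgeCount op J x u v :=
      Finset.sum_congr rfl fun i hi => by rw [hadj i hi u v]
    rw [h1, h2]

/-- A rule that outputs any decodable graph with the given unlabelled traces is correct on
decodable outcomes. -/
theorem exists_reconstructor (op : SimpleGraph (Fin n) → SimpleGraph (Fin n) → SimpleGraph (Fin n))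
    (s τ : ℝ) (J : Finset (Fin m)) (dec : ℝ → ℝ → Prop) :
    ∃ R : Reconstructor n m, ∀ x, Decodable op s τ J dec x →
      Nonempty (R (fun i => (noisyTrace op x i).unlabel) ≃g x.1) := by
  classical
  let R : Reconstructor n m := fun t =>
    if h : ∃ x, Decodable op s τ J dec x ∧ (fun i => (noisyTrace op x i).unlabel) = t
    then h.choose.1 else ⊥
  refine ⟨R, fun x hx => ?_⟩
  have h : ∃ y, Decodable op s τ J dec y ∧
    (fun i => (noisyTrace op y i).unlabel) = fun i => (noisyTrace op x i).unlabel := ⟨x, hx, rfl⟩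
  have hR : R (fun i => (noisyTrace op x i).unlabel) = h.choose.1 := dif_pos h
  rw [hR]
  refine h.choose_spec.1.nonempty_iso hx fun i => ?_
  exact Quotient.exact (s := labelledTraceSetoid n) (congrFun h.choose_spec.2 i)

/-- If the number of common vertices, the numbers of common neighbours and the numbers of agreements
of far-from-identity matchings behave as expected, then two traces are aligned correctly.
A matching that moves only few vertices is excluded by looking at a single moved vertex. -/
theorem alignsCorrectly_of_concentration {r γ k : ℝ} {x : NoiseSpace n m} {i j : Fin m}
    (hγ : 0 < γ) (hr1 : r ^ 2 + γ ≤ 1) (hk : 32 ≤ γ * k)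
    (hlow : (1 - γ / 16) * k < ∑ z, bothSampled i j z x)
    (hupp : ∑ z, bothSampled i j z x < (1 + γ / 16) * k)
    (htrue : ∀ u, ∑ z ∈ Finset.univ.erase u, bothSampled i j z x *
        ((r ^ 2 + 3 * γ / 4) - bothEdges op i j s(u, z) s(u, z) x) < 0)
    (hfalse : ∀ u w, u ≠ w → ∑ z ∈ (Finset.univ.erase u).erase w, bothSampled i j z x *
        (bothEdges op i j s(u, z) s(w, z) x - (r ^ 2 + γ / 4)) < 0)
    (hfar : ∀ (K : ℕ) (a b : Fin K → Fin n), Function.Injective a → Function.Injective b →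
      (1 - γ / 16) * k ≤ K → γ * k / 8 ≤ ∑ l, ind (a l ≠ b l) →
      ∃ l, ∑ l', bothEdges op i j s(a l, a l') s(b l, b l') x < (r ^ 2 + γ / 2) * K) :
    AlignsCorrectly op ((1 - γ / 16) * k) (r ^ 2 + γ / 2) x i j := by
  classical
  have hr0 : 0 ≤ r ^ 2 := sq_nonneg r
  have hγ1 : γ ≤ 1 := by linarith
  have hk0 : 0 < k := pos_of_mul_pos_right (lt_of_lt_of_le (by norm_num) hk) hγ.le
  have hs0 : ∀ z, 0 ≤ bothSampled i j z x := fun _ => ind_nonneg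
  have hs1 : ∀ z, bothSampled i j z x ≤ 1 := fun _ => ind_le_one
  rintro ⟨u, hu⟩ ⟨w, hw⟩
  constructor
  · rintro ⟨K, a, b, hK, ha, hb, ⟨l, hlu, hlw⟩, hdeg⟩
    change u = w
    by_contra huw
    let a' : Fin K → Fin n := fun l => (a l).1
    let b' : Fin K → Fin n := fun l => (b l).1
    have ha' : Function.Injective a' := Subtype.val_injective.comp ha
    have hb' : Function.Injective b' := Subtype.val_injective.comp hb
    have hdeg' : ∀ l, (r ^ 2 + γ / 2) * K ≤
        ∑ l', bothEdges op i j s(a' l, a' l') s(b' l, b' l') x := fun l => hdeg l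
    rcases le_or_gt (γ * k / 8) (∑ l, ind (a' l ≠ b' l)) with hd | hd
    · obtain ⟨l', hl'⟩ := hfar K a' b' ha' hb' hK hd
      exact absurd (hdeg' l') (not_le.2 hl')
    · have hau : a' l = u := congrArg Subtype.val hlu
      have hbw : b' l = w := congrArg Subtype.val hlw
      have h1 := hdeg' l
      rw [hau, hbw] at h1
      -- The fixed vertices contribute at most as many agreements as the whole common part.
      have h2 : ∑ l', bothEdges op i j s(u, a' l') s(w, b' l') x ≤
          ∑ l', ind (a' l' ≠ b' l') +
            ∑ z, bothSampled i j z x * bothEdges op i j s(u, z) s(w, z) x := by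
        have h3 : ∑ l' with a' l' = b' l',
            bothSampled i j (a' l') x * bothEdges op i j s(u, a' l') s(w, a' l') x ≤
            ∑ z, bothSampled i j z x * bothEdges op i j s(u, z) s(w, z) x := by
          rw [← Finset.sum_image (g := a') (f := fun z =>
            bothSampled i j z x * bothEdges op i j s(u, z) s(w, z) x) ha'.injOn]
          exact Finset.sum_le_sum_of_subset_of_nonneg (Finset.subset_univ _)
            fun z _ _ => mul_nonneg (hs0 z) ind_nonneg
        refine le_trans ?_ (add_le_add_right h3 _)
        rw [Finset.sum_filter, ← Finset.sum_add_distrib]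
        refine Finset.sum_le_sum fun l' _ => ?_
        by_cases hl : a' l' = b' l'
        · have hmem : bothSampled i j (a' l') x = 1 :=
            ind_of_true ⟨(a l').2, by rw [hl]; exact (b l').2⟩
          rw [if_pos hl, hmem, ind_of_false (not_not.2 hl), ← hl]
          simp
        · rw [if_neg hl, ind_of_true hl, add_zero]
          exact ind_le_one
      have h4 : ∑ z, bothSampled i j z x * bothEdges op i j s(u, z) s(w, z) x =
          ∑ z ∈ (Finset.univ.erase u).erase w,
            bothSampled i j z x * bothEdges op i j s(u, z) s(w, z) x := by
        rw [← Finset.add_sum_erase _ _ (Finset.mem_univ u),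
          ← Finset.add_sum_erase _ _ (Finset.mem_erase.2 ⟨Ne.symm huw, Finset.mem_univ w⟩)]
        have e1 : bothEdges op i j s(u, u) s(w, u) x = 0 :=
          ind_of_false fun h => (noisyGraph op x i).irrefl h.1
        have e2 : bothEdges op i j s(u, w) s(w, w) x = 0 :=
          ind_of_false fun h => (noisyGraph op x j).irrefl h.2
        rw [e1, e2]
        simp
      have h5 := hfalse u w huw
      have h6 : ∑ z ∈ (Finset.univ.erase u).erase w, bothSampled i j z x ≤
          ∑ z, bothSampled i j z x :=
        Finset.sum_le_sum_of_subset_of_nonneg (Finset.subset_univ _) fun z _ _ => hs0 z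
      simp only [mul_sub, Finset.sum_sub_distrib, ← Finset.sum_mul] at h5
      have h7 : (r ^ 2 + γ / 2) * ((1 - γ / 16) * k) ≤ (r ^ 2 + γ / 2) * K :=
        mul_le_mul_of_nonneg_left hK (by linarith)
      have h8 : (∑ z ∈ (Finset.univ.erase u).erase w, bothSampled i j z x) * (r ^ 2 + γ / 4) ≤
          ((1 + γ / 16) * k) * (r ^ 2 + γ / 4) :=
        mul_le_mul_of_nonneg_right (by linarith) (by linarith)
      have h9 : (r ^ 2 + γ / 4) * (γ / 16 * k) ≤ 1 * (γ / 16 * k) :=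
        mul_le_mul_of_nonneg_right (by linarith) (by positivity)
      have h10 : (r ^ 2 + γ / 2) * (γ / 16 * k) ≤ 1 * (γ / 16 * k) :=
        mul_le_mul_of_nonneg_right (by linarith) (by positivity)
      nlinarith
  · intro huw
    change u = w at huw
    subst huw
    let I : Finset (Fin n) := Finset.univ.filter fun z => z ∈ (x.2 i).1 ∧ z ∈ (x.2 j).1
    have hI : ∀ z, z ∈ I ↔ z ∈ (x.2 i).1 ∧ z ∈ (x.2 j).1 := fun z => by simp [I]
    have hcard : ∑ z, bothSampled i j z x = (I.card : ℝ) :=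
      sum_ind Finset.univ fun z => z ∈ (x.2 i).1 ∧ z ∈ (x.2 j).1
    let g : Fin I.card ≃ I := I.equivFin.symm
    refine ⟨I.card, fun l => ⟨(g l).1, ((hI _).1 (g l).2).1⟩,
      fun l => ⟨(g l).1, ((hI _).1 (g l).2).2⟩,
      by rw [← hcard]; exact hlow.le, fun l l' h => ?_, fun l l' h => ?_, ?_, fun l => ?_⟩
    · exact g.injective (Subtype.ext (congrArg (fun z => z.1) h))
    · exact g.injective (Subtype.ext (congrArg (fun z => z.1) h))
    · refine ⟨g.symm ⟨u, (hI u).2 ⟨hu, hw⟩⟩, ?_, ?_⟩ <;> simp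
    · set v := (g l).1 with hv
      change (r ^ 2 + γ / 2) * I.card ≤
        ∑ l', bothEdges op i j s(v, (g l').1) s(v, (g l').1) x
      rw [g.sum_comp (fun z : I => bothEdges op i j s(v, z.1) s(v, z.1) x),
        Finset.sum_coe_sort I (fun z => bothEdges op i j s(v, z) s(v, z) x)]
      have h1 : ∑ z ∈ I, bothEdges op i j s(v, z) s(v, z) x =
          ∑ z, bothSampled i j z x * bothEdges op i j s(v, z) s(v, z) x := by
        rw [Finset.sum_filter]
        refine Finset.sum_congr rfl fun z _ => ?_
        by_cases hz : z ∈ (x.2 i).1 ∧ z ∈ (x.2 j).1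
        · rw [if_pos hz, bothSampled, ind_of_true hz, one_mul]
        · rw [if_neg hz, bothSampled, ind_of_false hz, zero_mul]
      have h2 := htrue v
      simp only [mul_sub, Finset.sum_sub_distrib, ← Finset.sum_mul] at h2
      have h3 : ∑ z ∈ Finset.univ.erase v,
          bothSampled i j z x * bothEdges op i j s(v, z) s(v, z) x ≤
          ∑ z, bothSampled i j z x * bothEdges op i j s(v, z) s(v, z) x :=
        Finset.sum_le_sum_of_subset_of_nonneg (Finset.subset_univ _)
          fun z _ _ => mul_nonneg (hs0 z) ind_nonneg
      have h4 : ∑ z, bothSampled i j z x ≤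
          1 + ∑ z ∈ Finset.univ.erase v, bothSampled i j z x := by
        rw [← Finset.add_sum_erase _ _ (Finset.mem_univ v)]
        linarith [hs1 v]
      rw [h1]
      rw [hcard] at h4 hlow
      have h5 : ((I.card : ℝ) - 1) * (r ^ 2 + 3 * γ / 4) ≤
          (∑ z ∈ Finset.univ.erase v, bothSampled i j z x) * (r ^ 2 + 3 * γ / 4) :=
        mul_le_mul_of_nonneg_right (by linarith) (by linarith)
      have h6 : γ * ((1 - γ / 16) * k) ≤ γ * I.card := mul_le_mul_of_nonneg_left hlow.le hγ.le
      nlinarith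

end Alignment

/-! ### The probability that an outcome is not decodable -/

section Probability

variable {n m : ℕ} {pv q : unitInterval}
  {op : SimpleGraph (Fin n) → SimpleGraph (Fin n) → SimpleGraph (Fin n)} {r γ : ℝ}

theorem Real.exp_neg_le_inv_pow {N : ℕ} {y : ℝ} (hn : 0 < n) (h : N * Real.log n ≤ y) :
    Real.exp (-y) ≤ ((n : ℝ) ^ N)⁻¹ := by
  have hn' : (0 : ℝ) < n := by exact_mod_cast hn
  rw [Real.exp_neg]
  refine inv_anti₀ (by positivity) ?_
  calc (n : ℝ) ^ N = Real.exp (N * Real.log n) := by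
        rw [Real.exp_nat_mul, Real.exp_log hn']
    _ ≤ Real.exp y := Real.exp_le_exp.2 h

theorem one_le_log_natCast (hn : 4 ≤ n) : 1 ≤ Real.log n := by
  have hn4 : (4 : ℝ) ≤ n := by exact_mod_cast hn
  rw [Real.le_log_iff_exp_le (by linarith)]
  linarith [Real.exp_one_lt_d9]

/-- Among ordered pairs that do not contain both orderings of any pair, passing to unordered pairs
is injective. -/
theorem injOn_sym2_of_swap_notMem {κ V : Type*} {F : Finset (κ × κ)} (hF : ∀ c ∈ F, c.swap ∉ F)
    {f : κ → V} (hf : Function.Injective f) :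
    Set.InjOn (fun c : κ × κ => s(f c.1, f c.2)) F := by
  intro c hc c' hc' h
  simp only [Sym2.eq_iff, hf.eq_iff] at h
  rcases h with h | h
  · exact Prod.ext h.1 h.2
  · exact absurd hc' ((Prod.ext h.2 h.1 : c.swap = c') ▸ hF c hc)

namespace IsNoiseModel

variable (M : IsNoiseModel n m pv q op r γ)

include M

/-- A matching that moves at least `d` of its `K` vertices rarely gives every matched vertex
noticeably more common neighbours than independent graphs would. -/
theorem measureReal_far_matching_le {i j : Fin m} (hγ : 0 < γ) (hr1 : r ^ 2 + γ ≤ 1) {K : ℕ}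
    {a b : Fin K → Fin n} (ha : Function.Injective a) (hb : Function.Injective b) {d : ℝ}
    (hd : d ≤ ∑ l, ind (a l ≠ b l)) (hK : 8 ≤ γ * K) :
    (graphAndNoise n m pv q).real
      {x | ∀ l, (r ^ 2 + γ / 2) * K ≤ ∑ l', bothEdges op i j s(a l, a l') s(b l, b l') x} ≤
      6 * Real.exp (-(γ ^ 2 * d * K / 384)) := by
  classical
  have hr0 : 0 ≤ r ^ 2 := sq_nonneg r
  set D : ℝ := ∑ l, ind (a l ≠ b l) with hD
  have hD0 : 0 ≤ D := Finset.sum_nonneg fun _ _ => ind_nonneg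
  let e : Fin K × Fin K → Sym2 (Fin n) := fun c => s(a c.1, a c.2)
  let e' : Fin K × Fin K → Sym2 (Fin n) := fun c => s(b c.1, b c.2)
  -- Ordered pairs whose first component is moved, split so that each pair occurs only once.
  let P₁ : Finset (Fin K × Fin K) :=
    Finset.univ.filter fun c => a c.1 ≠ b c.1 ∧ e c ≠ e' c ∧ c.1 < c.2
  let P₂ : Finset (Fin K × Fin K) :=
    Finset.univ.filter fun c => a c.1 ≠ b c.1 ∧ e c ≠ e' c ∧ c.2 < c.1
  have hswap₁ : ∀ c ∈ P₁, c.swap ∉ P₁ := fun c hc hc' =>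
    (Finset.mem_filter.1 hc).2.2.2.asymm (Finset.mem_filter.1 hc').2.2.2
  have hswap₂ : ∀ c ∈ P₂, c.swap ∉ P₂ := fun c hc hc' =>
    (Finset.mem_filter.1 hc).2.2.2.asymm (Finset.mem_filter.1 hc').2.2.2
  have key₁ := M.measureReal_sum_bothEdges_le (i := i) (j := j) hγ.le hr1 (F := P₁) (e := e)
    (e' := e') (injOn_sym2_of_swap_notMem hswap₁ ha)
    (injOn_sym2_of_swap_notMem hswap₁ hb) (fun c hc => (Finset.mem_filter.1 hc).2.2.1)
    (fun c hc => by simpa [e, ha.eq_iff] using (Finset.mem_filter.1 hc).2.2.2.ne)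
    (fun c hc => by simpa [e', hb.eq_iff] using (Finset.mem_filter.1 hc).2.2.2.ne)
    (γ * D * K / 16)
  have key₂ := M.measureReal_sum_bothEdges_le (i := i) (j := j) hγ.le hr1 (F := P₂) (e := e)
    (e' := e') (injOn_sym2_of_swap_notMem hswap₂ ha)
    (injOn_sym2_of_swap_notMem hswap₂ hb) (fun c hc => (Finset.mem_filter.1 hc).2.2.1)
    (fun c hc => by simpa [e, ha.eq_iff] using (Finset.mem_filter.1 hc).2.2.2.ne')
    (fun c hc => by simpa [e', hb.eq_iff] using (Finset.mem_filter.1 hc).2.2.2.ne')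
    (γ * D * K / 16)
  have hcard : (P₁.card : ℝ) + P₂.card ≤ D * K := by
    rw [hD, Finset.sum_mul]
    have hK' : ∀ l, ind (a l ≠ b l) * (K : ℝ) = ∑ l' : Fin K, ind (a l ≠ b l) := by
      intro l; simp [mul_comm]
    simp only [hK']
    rw [← Fintype.sum_prod_type' (f := fun l (_ : Fin K) => ind (a l ≠ b l)), ← sum_ind, ← sum_ind,
      ← Finset.sum_add_distrib]
    refine Finset.sum_le_sum fun c _ => ?_
    by_cases h : a c.1 ≠ b c.1
    · rw [ind_of_true h]
      by_cases h' : c.1 < c.2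
      · rw [ind_of_false (p := _ ∧ _ ∧ c.2 < c.1) fun hc => hc.2.2.asymm h', add_zero]
        exact ind_le_one
      · rw [ind_of_false (p := _ ∧ _ ∧ c.1 < c.2) fun hc => h' hc.2.2, zero_add]
        exact ind_le_one
    · rw [ind_of_false (p := _ ∧ _ ∧ c.2 < c.1) fun hc => h hc.1,
        ind_of_false (p := _ ∧ _ ∧ c.1 < c.2) fun hc => h hc.1, ind_of_false h, add_zero]
  have hsub : {x : NoiseSpace n m | ∀ l, (r ^ 2 + γ / 2) * K ≤
      ∑ l', bothEdges op i j s(a l, a l') s(b l, b l') x} ⊆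
      {x | γ * D * K / 16 ≤ ∑ c ∈ P₁, (bothEdges op i j (e c) (e' c) x - (r ^ 2 + γ / 4))} ∪
      {x | γ * D * K / 16 ≤ ∑ c ∈ P₂, (bothEdges op i j (e c) (e' c) x - (r ^ 2 + γ / 4))} := by
    intro x hx
    simp only [Set.mem_ofPred_eq, Set.mem_union] at hx ⊢
    have h1 : D * ((r ^ 2 + γ / 2) * K) ≤
        ∑ l, ∑ l', ind (a l ≠ b l) * bothEdges op i j s(a l, a l') s(b l, b l') x := by
      rw [hD, Finset.sum_mul]
      refine Finset.sum_le_sum fun l _ => ?_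
      rw [← Finset.mul_sum]
      exact mul_le_mul_of_nonneg_left (hx l) ind_nonneg
    have h2 : ∑ l, ∑ l', ind (a l ≠ b l) * bothEdges op i j s(a l, a l') s(b l, b l') x ≤
        ∑ c ∈ P₁, bothEdges op i j (e c) (e' c) x + ∑ c ∈ P₂, bothEdges op i j (e c) (e' c) x +
          ∑ l, ∑ l', ind (a l ≠ b l) * ind (a l = b l') := by
      rw [← Fintype.sum_prod_type' (f := fun l l' =>
          ind (a l ≠ b l) * bothEdges op i j s(a l, a l') s(b l, b l') x),
        ← Fintype.sum_prod_type' (f := fun l l' => ind (a l ≠ b l) * ind (a l = b l')),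
        Finset.sum_filter, Finset.sum_filter, ← Finset.sum_add_distrib, ← Finset.sum_add_distrib]
      refine Finset.sum_le_sum fun c _ => ?_
      have hb0 : 0 ≤ bothEdges op i j (e c) (e' c) x := ind_nonneg
      have hb1 : bothEdges op i j (e c) (e' c) x ≤ 1 := ind_le_one
      change ind (a c.1 ≠ b c.1) * bothEdges op i j (e c) (e' c) x ≤ _
      by_cases h : a c.1 ≠ b c.1
      · rw [ind_of_true h, one_mul, one_mul]
        by_cases hee : e c = e' c
        · -- The pair is fixed by exchanging its two vertices.
          have hsw : a c.1 = b c.2 := by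
            rcases Sym2.eq_iff.1 hee with h' | h'
            · exact (h h'.1).elim
            · exact h'.1
          rw [ind_of_true hsw]
          rw [if_neg fun hc => hc.2.1 hee, if_neg fun hc => hc.2.1 hee]
          linarith
        · have h0 : 0 ≤ ind (a c.1 = b c.2) := ind_nonneg
          rcases lt_trichotomy c.1 c.2 with h' | h' | h'
          · rw [if_pos ⟨h, hee, h'⟩, if_neg fun hc => hc.2.2.asymm h']
            linarith
          · have : bothEdges op i j (e c) (e' c) x = 0 := by
              refine ind_of_false fun hc => ?_
              have := hc.1
              simp only [e, h'] at this
              exact (noisyGraph op x i).irrefl this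
            rw [this]
            simp [h0]
          · rw [if_neg fun hc => hc.2.2.asymm h', if_pos ⟨h, hee, h'⟩]
            linarith
      · rw [ind_of_false h, if_neg fun hc => h hc.1, if_neg fun hc => h hc.1]
        simp
    have h3 : ∑ l, ∑ l', ind (a l ≠ b l) * ind (a l = b l') ≤ D := by
      refine Finset.sum_le_sum fun l _ => ?_
      rw [← Finset.mul_sum]
      refine mul_le_of_le_one_right ind_nonneg ?_
      rw [sum_ind]
      have hone : (Finset.univ.filter fun l' => a l = b l').card ≤ 1 := by
        refine Finset.card_le_one.2 fun l₁ h₁ l₂ h₂ => hb ?_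
        rw [← (Finset.mem_filter.1 h₁).2, ← (Finset.mem_filter.1 h₂).2]
      exact_mod_cast hone
    by_contra! hcon
    obtain ⟨c1, c2⟩ := hcon
    simp only [Finset.sum_sub_distrib, Finset.sum_const, nsmul_eq_mul] at c1 c2
    have h4 : ((P₁.card : ℝ) + P₂.card) * (r ^ 2 + γ / 4) ≤ D * K * (r ^ 2 + γ / 4) :=
      mul_le_mul_of_nonneg_right hcard (by linarith)
    have h5 : D * 8 ≤ D * (γ * K) := mul_le_mul_of_nonneg_left hK hD0
    nlinarith
  have hexp : Real.exp (-(γ * (γ * D * K / 16) / 24)) ≤ Real.exp (-(γ ^ 2 * d * K / 384)) := by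
    refine Real.exp_le_exp.2 ?_
    have : γ ^ 2 * K * d ≤ γ ^ 2 * K * D := mul_le_mul_of_nonneg_left hd (by positivity)
    linarith
  refine (measureReal_mono hsub (measure_ne_top _ _)).trans
    ((measureReal_union_le _ _).trans ?_)
  linarith

/-- Two traces are aligned correctly with high probability. The constant is `20 * 3072`: moving
`γ k / 8` vertices has probability at most `6 * exp (-γ ^ 3 k K / 3072)`, and `n ^ (-20 K)` is small
compared with the number of matchings of `K` vertices. -/
theorem measureReal_not_alignsCorrectly_le {i j : Fin m} (hij : i ≠ j) (hn : 4 ≤ n) (hγ : 0 < γ)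
    (hr1 : r ^ 2 + γ ≤ 1) (hC : 61440 * Real.log n ≤ γ ^ 3 * ((pv : ℝ) ^ 2 * n)) :
    (graphAndNoise n m pv q).real
      {x | ¬ AlignsCorrectly op ((1 - γ / 16) * ((pv : ℝ) ^ 2 * n)) (r ^ 2 + γ / 2) x i j} ≤
      ((n : ℝ) ^ 15)⁻¹ := by
  classical
  set μ := graphAndNoise n m pv q with hμ
  set k : ℝ := (pv : ℝ) ^ 2 * n with hk
  have hr0 : 0 ≤ r ^ 2 := sq_nonneg r
  have hγ1 : γ ≤ 1 := by linarith
  have hn4 : (4 : ℝ) ≤ n := by exact_mod_cast hn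
  have hn0 : (0 : ℝ) < n := by linarith
  have hk0 : 0 ≤ k := by positivity
  have hlog : 1 ≤ Real.log n := one_le_log_natCast hn
  have hγ2k : 61440 * Real.log n ≤ γ ^ 2 * k := by
    have : γ ^ 3 * k ≤ γ ^ 2 * k :=
      mul_le_mul_of_nonneg_right (pow_le_pow_of_le_one hγ.le hγ1 (by norm_num)) hk0
    linarith
  have hγk : 61440 * Real.log n ≤ γ * k := by
    have : γ ^ 2 * k ≤ γ * k :=
      mul_le_mul_of_nonneg_right (pow_le_of_le_one hγ.le hγ1 (by norm_num)) hk0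
    linarith
  -- The exceptional events: an unexpected number of common vertices, too few true or too many
  -- false agreements, and a far matching of `K` vertices with many agreements.
  let A : ℝ → Set (NoiseSpace n m) := fun ε =>
    {x | γ / 16 * k ≤ ε * (∑ z, bothSampled i j z x - k)}
  let A₃ : Fin n → Set (NoiseSpace n m) := fun u =>
    {x | 0 ≤ ∑ z ∈ Finset.univ.erase u, bothSampled i j z x *
        ((r ^ 2 + 3 * γ / 4) - bothEdges op i j s(u, z) s(u, z) x)}
  let A₄ : Fin n → Fin n → Set (NoiseSpace n m) := fun u w =>
    {x | u ≠ w ∧ 0 ≤ ∑ z ∈ (Finset.univ.erase u).erase w, bothSampled i j z x *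
        (bothEdges op i j s(u, z) s(w, z) x - (r ^ 2 + γ / 4))}
  let A₅ : (K : ℕ) → (Fin K → Fin n) → (Fin K → Fin n) → Set (NoiseSpace n m) := fun K a b =>
    {x | (Function.Injective a ∧ Function.Injective b ∧ (1 - γ / 16) * k ≤ K ∧
      γ * k / 8 ≤ ∑ l, ind (a l ≠ b l)) ∧
      ∀ l, (r ^ 2 + γ / 2) * K ≤ ∑ l', bothEdges op i j s(a l, a l') s(b l, b l') x}
  have hA : ∀ ε : ℝ, ε ^ 2 = 1 → μ.real (A ε) ≤ ((n : ℝ) ^ 19)⁻¹ := by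
    intro ε hε
    refine (measureReal_card_bothSampled_deviation_le hij (δ := γ / 16) (by linarith)
      (by linarith) hε).trans (Real.exp_neg_le_inv_pow (by omega) ?_)
    have : n * ((γ / 16) ^ 2 * (pv : ℝ) ^ 2 / 4) = γ ^ 2 * k / 1024 := by rw [hk]; ring
    rw [this]; push_cast; linarith
  have hA₃ : ∀ u, μ.real (A₃ u) ≤ ((n : ℝ) ^ 19)⁻¹ := by
    intro u
    refine (M.measureReal_few_true_agreements_le hij hγ.le hr1 u).trans
      (Real.exp_neg_le_inv_pow (by omega) ?_)
    have : γ ^ 2 * k / 128 ≤ ((n : ℝ) - 1) * ((γ / 4) ^ 2 * (pv : ℝ) ^ 2 / 4) := by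
      have h : (n : ℝ) / 2 * ((γ / 4) ^ 2 * (pv : ℝ) ^ 2 / 4) ≤
          ((n : ℝ) - 1) * ((γ / 4) ^ 2 * (pv : ℝ) ^ 2 / 4) :=
        mul_le_mul_of_nonneg_right (by linarith) (by positivity)
      refine le_trans (le_of_eq ?_) h
      rw [hk]; ring
    push_cast; linarith
  have hA₄ : ∀ u w, μ.real (A₄ u w) ≤ ((n : ℝ) ^ 19)⁻¹ := by
    intro u w
    by_cases huw : u = w
    · have : A₄ u w = ∅ := by ext; simp [A₄, huw]
      rw [this, measureReal_empty]
      positivity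
    refine (measureReal_mono (fun x hx => hx.2) (measure_ne_top _ _)).trans
      ((M.measureReal_many_false_agreements_le hij hγ.le hr1 huw).trans
      (Real.exp_neg_le_inv_pow (by omega) ?_))
    have : γ ^ 2 * k / 128 ≤ ((n : ℝ) - 2) * ((γ / 4) ^ 2 * (pv : ℝ) ^ 2 / 4) := by
      have h : (n : ℝ) / 2 * ((γ / 4) ^ 2 * (pv : ℝ) ^ 2 / 4) ≤
          ((n : ℝ) - 2) * ((γ / 4) ^ 2 * (pv : ℝ) ^ 2 / 4) :=
        mul_le_mul_of_nonneg_right (by linarith) (by positivity)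
      refine le_trans (le_of_eq ?_) h
      rw [hk]; ring
    push_cast; linarith
  have hA₅ : ∀ K a b, μ.real (A₅ K a b) ≤ 6 * ((n : ℝ) ^ 18)⁻¹ * ((n : ℝ) ^ K * (n : ℝ) ^ K)⁻¹ := by
    intro K a b
    by_cases h : Function.Injective a ∧ Function.Injective b ∧ (1 - γ / 16) * k ≤ K ∧
      γ * k / 8 ≤ ∑ l, ind (a l ≠ b l)
    · obtain ⟨ha, hb, hK, hd⟩ := h
      have hγK : 8 ≤ γ * K := by
        have h1 : γ * ((1 - γ / 16) * k) ≤ γ * K := mul_le_mul_of_nonneg_left hK hγ.le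
        have h2 : γ / 16 * (γ * k) ≤ 1 / 16 * (γ * k) :=
          mul_le_mul_of_nonneg_right (by linarith) (by positivity)
        linarith
      have hK1 : 1 ≤ K := by
        by_contra h0
        have : K = 0 := by omega
        subst this
        norm_num at hγK
      refine (measureReal_mono (fun x hx => hx.2) (measure_ne_top _ _)).trans
        ((M.measureReal_far_matching_le hγ hr1 ha hb hd hγK).trans ?_)
      rw [mul_assoc 6]
      refine mul_le_mul_of_nonneg_left ?_ (by norm_num)
      have h1 : Real.exp (-(γ ^ 2 * (γ * k / 8) * K / 384)) ≤ ((n : ℝ) ^ (20 * K))⁻¹ := by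
        refine Real.exp_neg_le_inv_pow (by omega) ?_
        have : 61440 * Real.log n * K ≤ γ ^ 3 * k * K :=
          mul_le_mul_of_nonneg_right hC (by positivity)
        push_cast
        linarith
      refine h1.trans ?_
      rw [← pow_add, ← mul_inv, ← pow_add]
      exact inv_anti₀ (by positivity) (pow_le_pow_right₀ (by linarith) (by omega))
    · have : A₅ K a b = ∅ := by
        ext x
        simp only [A₅, Set.mem_ofPred_eq, Set.mem_empty_iff_false, iff_false]
        exact fun hx => h hx.1
      rw [this, measureReal_empty]
      positivity
  have hsub : {x | ¬ AlignsCorrectly op ((1 - γ / 16) * k) (r ^ 2 + γ / 2) x i j} ⊆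
      (A 1 ∪ A (-1)) ∪ ((⋃ u ∈ Finset.univ, A₃ u) ∪
        ((⋃ u ∈ Finset.univ, ⋃ w ∈ Finset.univ, A₄ u w) ∪
        ⋃ K ∈ Finset.range (n + 1), ⋃ a ∈ Finset.univ, ⋃ b ∈ Finset.univ, A₅ K a b)) := by
    intro x hx
    by_contra hcon
    simp only [Set.mem_union, Set.mem_iUnion, Finset.mem_univ, exists_prop, true_and,
      not_or, not_exists, not_and] at hcon
    obtain ⟨⟨h1, h2⟩, h3, h4, h5⟩ := hcon
    refine hx (alignsCorrectly_of_concentration hγ hr1 (by linarith) ?_ ?_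
      (fun u => not_le.1 (h3 u)) (fun u w huw => not_le.1 fun h => h4 u w ⟨huw, h⟩) ?_)
    · have : ¬ γ / 16 * k ≤ -1 * (∑ z, bothSampled i j z x - k) := h2
      linarith
    · have : ¬ γ / 16 * k ≤ 1 * (∑ z, bothSampled i j z x - k) := h1
      linarith
    · intro K a b ha hb hK hd
      by_contra! hall
      have hKn : K ≤ n := by simpa using Fintype.card_le_of_injective a ha
      exact h5 K (Finset.mem_range.2 (by omega)) a b ⟨⟨ha, hb, hK, hd⟩, hall⟩
  have hs₃ : μ.real (⋃ u ∈ Finset.univ, A₃ u) ≤ n * ((n : ℝ) ^ 19)⁻¹ := by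
    refine (measureReal_biUnion_finset_le _ _).trans
      ((Finset.sum_le_sum fun u _ => hA₃ u).trans_eq ?_)
    simp
  have hs₄ : μ.real (⋃ u ∈ Finset.univ, ⋃ w ∈ Finset.univ, A₄ u w) ≤
      n * (n * ((n : ℝ) ^ 19)⁻¹) := by
    refine (measureReal_biUnion_finset_le _ _).trans
      ((Finset.sum_le_sum fun u _ => (measureReal_biUnion_finset_le _ _).trans
        (Finset.sum_le_sum fun w _ => hA₄ u w)).trans_eq ?_)
    simp
  have hs₅ : μ.real (⋃ K ∈ Finset.range (n + 1), ⋃ a ∈ Finset.univ, ⋃ b ∈ Finset.univ, A₅ K a b) ≤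
      (n + 1) * (6 * ((n : ℝ) ^ 18)⁻¹) := by
    refine (measureReal_biUnion_finset_le _ _).trans
      ((Finset.sum_le_sum fun K _ => (measureReal_biUnion_finset_le _ _).trans
        (Finset.sum_le_sum fun a _ => (measureReal_biUnion_finset_le _ _).trans
        (Finset.sum_le_sum fun b _ => hA₅ K a b))).trans_eq ?_)
    simp only [Finset.sum_const, Finset.card_univ, Fintype.card_fun, Fintype.card_fin, nsmul_eq_mul,
      Nat.cast_pow]
    have : ∀ K : ℕ, (n : ℝ) ^ K * ((n : ℝ) ^ K *
        (6 * ((n : ℝ) ^ 18)⁻¹ * ((n : ℝ) ^ K * (n : ℝ) ^ K)⁻¹)) = 6 * ((n : ℝ) ^ 18)⁻¹ := by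
      intro K
      field_simp
    simp only [this]
    simp
  have htot : μ.real {x | ¬ AlignsCorrectly op ((1 - γ / 16) * k) (r ^ 2 + γ / 2) x i j} ≤
      ((n : ℝ) ^ 19)⁻¹ + ((n : ℝ) ^ 19)⁻¹ + (n * ((n : ℝ) ^ 19)⁻¹ +
        (n * (n * ((n : ℝ) ^ 19)⁻¹) + (n + 1) * (6 * ((n : ℝ) ^ 18)⁻¹))) := by
    refine (measureReal_mono hsub (measure_ne_top _ _)).trans ((measureReal_union_le _ _).trans
      (add_le_add ((measureReal_union_le _ _).trans (add_le_add (hA 1 (by norm_num))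
        (hA (-1) (by norm_num)))) ((measureReal_union_le _ _).trans (add_le_add hs₃
        ((measureReal_union_le _ _).trans (add_le_add hs₄ hs₅))))))
  refine htot.trans ?_
  have e19 : ((n : ℝ) ^ 19)⁻¹ = ((n : ℝ) ^ 15)⁻¹ * ((n : ℝ) ^ 4)⁻¹ := by
    rw [← mul_inv, ← pow_add]
  have e18 : ((n : ℝ) ^ 18)⁻¹ = ((n : ℝ) ^ 15)⁻¹ * (n * ((n : ℝ) ^ 4)⁻¹) := by
    field_simp
  rw [e19, e18]
  have hfac : (2 + n + n ^ 2 + 6 * (n + 1) * n) * ((n : ℝ) ^ 4)⁻¹ ≤ 1 := by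
    rw [mul_inv_le_iff₀ (by positivity), one_mul]
    nlinarith [mul_le_mul hn4 hn4 (by norm_num) hn0.le, sq_nonneg ((n : ℝ) ^ 2 - 16)]
  have hpos : 0 ≤ ((n : ℝ) ^ 15)⁻¹ := by positivity
  calc _ = ((n : ℝ) ^ 15)⁻¹ * ((2 + n + n ^ 2 + 6 * (n + 1) * n) * ((n : ℝ) ^ 4)⁻¹) := by ring
    _ ≤ ((n : ℝ) ^ 15)⁻¹ * 1 := mul_le_mul_of_nonneg_left hfac hpos
    _ = _ := mul_one _

/-- If the alignment signal `γ` is strong enough and a decision rule finds each edge with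
sufficient probability from polynomially many traces, then the graph can be reconstructed. -/
theorem exists_reconstructor_success (hn : 4 ≤ n) (hγ : 0 < γ)
    (hr1 : r ^ 2 + γ ≤ 1) (hC : 61440 * Real.log n ≤ γ ^ 3 * ((pv : ℝ) ^ 2 * n))
    {J : Finset (Fin m)} (hJ : J.card ≤ n ^ 3) {dec : ℝ → ℝ → Prop}
    (hdec : ∀ u v : Fin n, u ≠ v → (graphAndNoise n m pv q).real
      {x | ¬ (x.1.Adj u v ↔ dec (seenCount J x u v) (edgeCount op J x u v))} ≤ ((n : ℝ) ^ 4)⁻¹) :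
    ∃ R : Reconstructor n m, 1 - 1 / (n : ℝ) ≤ (graphAndNoise n m pv q).real
      {x | Nonempty (R (fun i => (noisyTrace op x i).unlabel) ≃g x.1)} := by
  classical
  set μ := graphAndNoise n m pv q with hμ
  have hn4 : (4 : ℝ) ≤ n := by exact_mod_cast hn
  have hn0 : (0 : ℝ) < n := by linarith
  set s : ℝ := (1 - γ / 16) * ((pv : ℝ) ^ 2 * n) with hs
  set τ : ℝ := r ^ 2 + γ / 2 with hτ
  obtain ⟨R, hR⟩ := exists_reconstructor op s τ J dec
  refine ⟨R, ?_⟩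
  have hgood : μ.real {x | Decodable op s τ J dec x} ≤
      μ.real {x | Nonempty (R (fun i => (noisyTrace op x i).unlabel) ≃g x.1)} :=
    measureReal_mono (fun x hx => hR x hx) (measure_ne_top _ _)
  refine le_trans ?_ hgood
  have hcompl : μ.real {x | Decodable op s τ J dec x}ᶜ =
      1 - μ.real {x | Decodable op s τ J dec x} :=
    probReal_compl_eq_one_sub .of_discrete
  let A : Fin m → Fin m → Set (NoiseSpace n m) := fun i j =>
    {x | i ≠ j ∧ ¬ AlignsCorrectly op s τ x i j}
  let D : Fin n → Fin n → Set (NoiseSpace n m) := fun u v =>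
    {x | u ≠ v ∧ ¬ (x.1.Adj u v ↔ dec (seenCount J x u v) (edgeCount op J x u v))}
  have hA : ∀ i j, μ.real (A i j) ≤ ((n : ℝ) ^ 15)⁻¹ := by
    intro i j
    by_cases hij : i = j
    · have : A i j = ∅ := by ext; simp [A, hij]
      rw [this, measureReal_empty]
      positivity
    · exact (measureReal_mono (fun x hx => hx.2) (measure_ne_top _ _)).trans
        (M.measureReal_not_alignsCorrectly_le hij hn hγ hr1 hC)
  have hD : ∀ u v, μ.real (D u v) ≤ ((n : ℝ) ^ 4)⁻¹ := by
    intro u v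
    by_cases huv : u = v
    · have : D u v = ∅ := by ext; simp [D, huv]
      rw [this, measureReal_empty]
      positivity
    · exact (measureReal_mono (fun x hx => hx.2) (measure_ne_top _ _)).trans (hdec u v huv)
  have hsub : {x | Decodable op s τ J dec x}ᶜ ⊆
      (⋃ i ∈ J, ⋃ j ∈ J, A i j) ∪ (⋃ u ∈ Finset.univ, ⋃ v ∈ Finset.univ, D u v) := by
    intro x hx
    by_contra hcon
    simp only [Set.mem_union, Set.mem_iUnion, Finset.mem_univ, exists_prop, true_and,
      not_or, not_exists, not_and] at hcon
    refine hx ⟨fun i hi j hj hij => ?_, fun u v huv => ?_⟩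
    · by_contra h
      exact hcon.1 i hi j hj ⟨hij, h⟩
    · by_contra h
      exact hcon.2 u v ⟨huv, h⟩
  have hJ' : (J.card : ℝ) ≤ (n : ℝ) ^ 3 := by exact_mod_cast hJ
  have h1 : μ.real (⋃ i ∈ J, ⋃ j ∈ J, A i j) ≤ ((n : ℝ) ^ 9)⁻¹ := by
    refine (measureReal_biUnion_finset_le _ _).trans
      ((Finset.sum_le_sum fun u _ => (measureReal_biUnion_finset_le _ _).trans
        (Finset.sum_le_sum fun w _ => hA u w)).trans ?_)
    simp only [Finset.sum_const, nsmul_eq_mul]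
    calc (J.card : ℝ) * (J.card * ((n : ℝ) ^ 15)⁻¹)
        ≤ (n : ℝ) ^ 3 * ((n : ℝ) ^ 3 * ((n : ℝ) ^ 15)⁻¹) := by gcongr
      _ = ((n : ℝ) ^ 9)⁻¹ := by field_simp
  have h2 : μ.real (⋃ u ∈ Finset.univ, ⋃ v ∈ Finset.univ, D u v) ≤ ((n : ℝ) ^ 2)⁻¹ := by
    refine (measureReal_biUnion_finset_le _ _).trans
      ((Finset.sum_le_sum fun u _ => (measureReal_biUnion_finset_le _ _).trans
        (Finset.sum_le_sum fun w _ => hD u w)).trans_eq ?_)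
    simp only [Finset.sum_const, nsmul_eq_mul, Finset.card_univ, Fintype.card_fin]
    field_simp
  have h3 : ((n : ℝ) ^ 9)⁻¹ ≤ ((n : ℝ) ^ 2)⁻¹ :=
    inv_anti₀ (by positivity) (pow_le_pow_right₀ (by linarith) (by norm_num))
  have h4 : ((n : ℝ) ^ 2)⁻¹ + ((n : ℝ) ^ 2)⁻¹ ≤ 1 / n := by
    rw [← two_mul, ← div_eq_mul_inv, div_le_div_iff₀ (by positivity) hn0]
    nlinarith
  have h5 := (measureReal_mono hsub (measure_ne_top μ _)).trans (measureReal_union_le _ _)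
  rw [hcompl] at h5
  linarith

end IsNoiseModel

end Probability

/-! ### Edge deletion and edge flips -/

section Noise

variable {n m : ℕ} {pv q : unitInterval}

/-- The expectation of a product of indicators of different bits. -/
theorem integral_prod_ind_noiseBit (S : Finset (BitIndex n m)) :
    ∫ x, ∏ t ∈ S, ind (noiseBit t x) ∂(graphAndNoise n m pv q) =
      ∏ t ∈ S, (graphAndNoise n m pv q).real {x | noiseBit t x} := by
  rw [integral_prod_of_dependsOnBits (iIndepFun_noiseBit n m pv q) (T := fun t => {t})]
  · exact Finset.prod_congr rfl fun t _ => integral_ind _ _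
  · intro t _ t' _ h
    simpa using h
  · intro t _ x y h
    exact congrArg ind (propext (h t (Finset.mem_singleton_self t)))

theorem integral_ind_mark {i : Fin m} {e : Sym2 (Fin n)} (he : ¬ e.IsDiag) :
    ∫ x, ind (e ∈ (x.2 i).2.edgeSet) ∂(graphAndNoise n m pv q) = q :=
  (integral_ind _ _).trans (graphAndNoise_real_mark pv q i he)

theorem integral_ind_edge {e : Sym2 (Fin n)} (he : ¬ e.IsDiag) :
    ∫ x, ind (e ∈ x.1.edgeSet) ∂(graphAndNoise n m pv q) = 1 / 2 :=
  (integral_ind _ _).trans (graphAndNoise_real_edge pv q he)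

theorem integral_ind_edge_mul_mark {i : Fin m} {e : Sym2 (Fin n)} (he : ¬ e.IsDiag) :
    ∫ x, ind (e ∈ x.1.edgeSet) * ind (e ∈ (x.2 i).2.edgeSet) ∂(graphAndNoise n m pv q) =
      1 / 2 * q := by
  have h := integral_prod_ind_noiseBit (pv := pv) (q := q)
    ({.inl e, .inr (i, .inr e)} : Finset (BitIndex n m))
  simp only [Finset.prod_pair (show (Sum.inl e : BitIndex n m) ≠ .inr (i, .inr e) by simp),
    graphAndNoise_real_edge pv q he, graphAndNoise_real_mark pv q i he] at h
  exact h

theorem integral_ind_mark_mul_mark {i j : Fin m} (hij : i ≠ j) {e : Sym2 (Fin n)}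
    (he : ¬ e.IsDiag) :
    ∫ x, ind (e ∈ (x.2 i).2.edgeSet) * ind (e ∈ (x.2 j).2.edgeSet) ∂(graphAndNoise n m pv q) =
      (q : ℝ) * q := by
  have h := integral_prod_ind_noiseBit (pv := pv) (q := q)
    ({.inr (i, .inr e), .inr (j, .inr e)} : Finset (BitIndex n m))
  simp only [Finset.prod_pair
    (show (Sum.inr (i, .inr e) : BitIndex n m) ≠ .inr (j, .inr e) by simpa using hij),
    graphAndNoise_real_mark pv q _ he] at h
  exact h

theorem integral_ind_edge_mul_mark_mul_mark {i j : Fin m} (hij : i ≠ j) {e : Sym2 (Fin n)}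
    (he : ¬ e.IsDiag) :
    ∫ x, ind (e ∈ x.1.edgeSet) * (ind (e ∈ (x.2 i).2.edgeSet) * ind (e ∈ (x.2 j).2.edgeSet))
      ∂(graphAndNoise n m pv q) = 1 / 2 * ((q : ℝ) * q) := by
  have h := integral_prod_ind_noiseBit (pv := pv) (q := q)
    ({.inl e, .inr (i, .inr e), .inr (j, .inr e)} : Finset (BitIndex n m))
  rw [Finset.prod_insert (by simp)] at h
  simp only [Finset.prod_insert
      (show (Sum.inl e : BitIndex n m) ∉ ({.inr (i, .inr e), .inr (j, .inr e)} : Finset _) by simp),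
    Finset.prod_pair
    (show (Sum.inr (i, .inr e) : BitIndex n m) ≠ .inr (j, .inr e) by simpa using hij),
    graphAndNoise_real_edge pv q he, graphAndNoise_real_mark pv q _ he] at h
  exact h

/-- The indicator that both `u` and `v` are sampled in the `i`-th trace. -/
noncomputable def pairSampled (i : Fin m) (u v : Fin n) (x : NoiseSpace n m) : ℝ :=
  ind (u ∈ (x.2 i).1 ∧ v ∈ (x.2 i).1)

/-- The bits of the `i`-th trace that concern the vertices `u` and `v` and the pair of them. -/
def pairBlock (i : Fin m) (u v : Fin n) : Finset (BitIndex n m) :=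
  {.inr (i, .inl u), .inr (i, .inl v), .inr (i, .inr s(u, v))}

theorem disjoint_pairBlock {i j : Fin m} (hij : i ≠ j) (u v : Fin n) :
    Disjoint (pairBlock i u v) (pairBlock j u v) := by
  rw [Finset.disjoint_left]
  intro t ht ht'
  simp only [pairBlock, Finset.mem_insert, Finset.mem_singleton] at ht ht'
  grind

theorem dependsOnBits_pairSampled (i : Fin m) (u v : Fin n) :
    DependsOnBits noiseBit (pairBlock i u v) (pairSampled i u v) := by
  intro x y h
  have h1 : u ∈ (x.2 i).1 ↔ u ∈ (y.2 i).1 := h (.inr (i, .inl u)) (by simp [pairBlock])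
  have h2 : v ∈ (x.2 i).1 ↔ v ∈ (y.2 i).1 := h (.inr (i, .inl v)) (by simp [pairBlock])
  simp only [pairSampled, h1, h2]

theorem dependsOnBits_mark (i : Fin m) (u v : Fin n) :
    DependsOnBits noiseBit (pairBlock i u v) (fun x => s(u, v) ∈ (x.2 i).2.edgeSet) := by
  intro x y h
  exact propext (h (.inr (i, .inr s(u, v))) (by simp [pairBlock]))

theorem integral_pairSampled (i : Fin m) {u v : Fin n} (huv : u ≠ v) :
    ∫ x, pairSampled i u v x ∂(graphAndNoise n m pv q) = (pv : ℝ) ^ 2 := by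
  have h := integral_prod_ind_noiseBit (pv := pv) (q := q)
    ({.inr (i, .inl u), .inr (i, .inl v)} : Finset (BitIndex n m))
  simp only [Finset.prod_pair
    (show (Sum.inr (i, .inl u) : BitIndex n m) ≠ .inr (i, .inl v) by simpa using huv),
    graphAndNoise_real_vertex pv q, ← sq] at h
  rw [← h]
  exact integral_congr_ae (.of_forall fun x => ind_and)

theorem integral_pairSampled_mul_mark (i : Fin m) {u v : Fin n} (huv : u ≠ v) :
    ∫ x, pairSampled i u v x * ind (s(u, v) ∈ (x.2 i).2.edgeSet) ∂(graphAndNoise n m pv q) =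
      (pv : ℝ) ^ 2 * q := by
  have he : ¬ (s(u, v) : Sym2 (Fin n)).IsDiag := by simpa using huv
  have h := integral_prod_ind_noiseBit (pv := pv) (q := q) (pairBlock i u v)
  have hn : (Sum.inr (i, .inl u) : BitIndex n m) ∉
      ({.inr (i, .inl v), .inr (i, .inr s(u, v))} : Finset (BitIndex n m)) := by simpa using huv
  simp only [pairBlock, Finset.prod_insert hn, Finset.prod_pair
    (show (Sum.inr (i, .inl v) : BitIndex n m) ≠ .inr (i, .inr s(u, v)) by simp),
    graphAndNoise_real_vertex pv q, graphAndNoise_real_mark pv q _ he] at h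
  rw [sq, mul_assoc, ← h]
  refine integral_congr_ae (.of_forall fun x => ?_)
  simp only [pairSampled, ind_and, mul_assoc]
  rfl

theorem isNoiseModel_deletion (n m : ℕ) (pv pe : unitInterval) :
    IsNoiseModel n m pv pe (fun G K => G ⊓ K) ((pe : ℝ) / 2) ((pe : ℝ) ^ 2 / 4) where
  edge_congr G K G' K' e h h' := by
    simp only [SimpleGraph.edgeSet_inf, Set.mem_inter_iff, h, h']
  prob_edge i e he := by
    rw [← integral_ind]
    simp only [noisyGraph, SimpleGraph.edgeSet_inf, Set.mem_inter_iff, ind_and]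
    rw [integral_ind_edge_mul_mark he]
    ring
  prob_both i j hij e he := by
    rw [← integral_ind]
    have h : ∀ x : NoiseSpace n m, ind (e ∈ (noisyGraph (fun G K => G ⊓ K) x i).edgeSet ∧
        e ∈ (noisyGraph (fun G K => G ⊓ K) x j).edgeSet) = ind (e ∈ x.1.edgeSet) *
          (ind (e ∈ (x.2 i).2.edgeSet) * ind (e ∈ (x.2 j).2.edgeSet)) := by
      intro x
      simp only [noisyGraph, SimpleGraph.edgeSet_inf, Set.mem_inter_iff, ind_and]
      linear_combination (ind (e ∈ (x.2 i).2.edgeSet) * ind (e ∈ (x.2 j).2.edgeSet)) *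
        ind_sq (p := e ∈ x.1.edgeSet)
    simp only [h]
    rw [integral_ind_edge_mul_mark_mul_mark hij he]
    ring

theorem mem_edgeSet_symmDiff {V : Type*} (G K : SimpleGraph V) (e : Sym2 V) :
    e ∈ (symmDiff G K).edgeSet ↔
      (e ∈ G.edgeSet ∧ e ∉ K.edgeSet) ∨ (e ∈ K.edgeSet ∧ e ∉ G.edgeSet) := by
  simp [symmDiff_def, SimpleGraph.edgeSet_sup, SimpleGraph.edgeSet_sdiff]

theorem ind_mem_edgeSet_symmDiff {V : Type*} (G K : SimpleGraph V) (e : Sym2 V) :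
    ind (e ∈ (symmDiff G K).edgeSet) = ind (e ∈ G.edgeSet) + ind (e ∈ K.edgeSet) -
      2 * (ind (e ∈ G.edgeSet) * ind (e ∈ K.edgeSet)) := by
  rw [mem_edgeSet_symmDiff]
  by_cases h : e ∈ G.edgeSet <;> by_cases h' : e ∈ K.edgeSet <;> norm_num [ind, h, h']

theorem isNoiseModel_flip (n m : ℕ) (pv fe : unitInterval) :
    IsNoiseModel n m pv fe (fun G K => symmDiff G K) (1 / 2) ((1 / 2 - (fe : ℝ)) ^ 2) where
  edge_congr G K G' K' e h h' := by
    simp only [mem_edgeSet_symmDiff, h, h']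
  prob_edge i e he := by
    have hi : ∀ f : NoiseSpace n m → ℝ, Integrable f (graphAndNoise n m pv fe) :=
      fun f => .of_finite
    rw [← integral_ind]
    simp only [noisyGraph, ind_mem_edgeSet_symmDiff]
    rw [integral_sub (hi _) (hi _), integral_add (hi _) (hi _), integral_const_mul,
      integral_ind_edge_mul_mark he, integral_ind_edge he, integral_ind_mark he]
    ring
  prob_both i j hij e he := by
    have hi : ∀ f : NoiseSpace n m → ℝ, Integrable f (graphAndNoise n m pv fe) :=
      fun f => .of_finite
    rw [← integral_ind]
    have h : ∀ x : NoiseSpace n m,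
        ind (e ∈ (noisyGraph (fun G K => symmDiff G K) x i).edgeSet ∧
        e ∈ (noisyGraph (fun G K => symmDiff G K) x j).edgeSet) =
        ind (e ∈ x.1.edgeSet) - ind (e ∈ x.1.edgeSet) * ind (e ∈ (x.2 i).2.edgeSet) -
          ind (e ∈ x.1.edgeSet) * ind (e ∈ (x.2 j).2.edgeSet) +
          ind (e ∈ (x.2 i).2.edgeSet) * ind (e ∈ (x.2 j).2.edgeSet) := by
      intro x
      simp only [noisyGraph, ind_and, ind_mem_edgeSet_symmDiff]
      linear_combination (1 - 2 * ind (e ∈ (x.2 i).2.edgeSet)) *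
        (1 - 2 * ind (e ∈ (x.2 j).2.edgeSet)) * ind_sq (p := e ∈ x.1.edgeSet)
    simp only [h]
    rw [integral_add (hi _) (hi _), integral_sub (hi _) (hi _), integral_sub (hi _) (hi _),
      integral_ind_edge he, integral_ind_edge_mul_mark he, integral_ind_edge_mul_mark he,
      integral_ind_mark_mul_mark hij he]
    ring

/-- In the deletion model, declaring a pair an edge as soon as it is seen as an edge once errs only
if no trace contains both vertices with the pair marked as kept. -/
theorem measureReal_deletion_error_le (J : Finset (Fin m)) {u v : Fin n} (huv : u ≠ v) :
    (graphAndNoise n m pv q).real {x | ¬ (x.1.Adj u v ↔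
      0 < edgeCount (fun G K => G ⊓ K) J x u v)} ≤
      Real.exp (-(J.card * ((pv : ℝ) ^ 2 * q))) := by
  let Y : Fin m → NoiseSpace n m → ℝ := fun i x =>
    1 - pairSampled i u v x * ind (s(u, v) ∈ (x.2 i).2.edgeSet)
  have hi : ∀ f : NoiseSpace n m → ℝ, Integrable f (graphAndNoise n m pv q) := fun f => .of_finite
  have hY0 : ∀ i x, 0 ≤ Y i x := by
    intro i x
    have h1 : pairSampled i u v x ≤ 1 := ind_le_one
    have h2 : ind (s(u, v) ∈ (x.2 i).2.edgeSet) ≤ 1 := ind_le_one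
    have h3 : 0 ≤ ind (s(u, v) ∈ (x.2 i).2.edgeSet) := ind_nonneg
    simp only [Y, sub_nonneg]
    exact mul_le_one₀ h1 h3 h2
  have hYi : ∀ i, ∫ x, Y i x ∂(graphAndNoise n m pv q) = 1 - (pv : ℝ) ^ 2 * q := by
    intro i
    simp only [Y]
    rw [integral_sub (hi _) (hi _), integral_pairSampled_mul_mark i huv]
    simp
  have hprod := integral_prod_of_dependsOnBits (iIndepFun_noiseBit n m pv q) (F := J)
    (T := fun i => pairBlock i u v) (fun i _ j _ hij => disjoint_pairBlock hij u v) (f := Y)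
    (fun i _ x y h => by
      have h1 := dependsOnBits_mark i u v x y h
      simp only at h1
      simp only [Y, dependsOnBits_pairSampled i u v x y h, h1])
  have hle : (graphAndNoise n m pv q).real {x | ¬ (x.1.Adj u v ↔
      0 < edgeCount (fun G K => G ⊓ K) J x u v)} ≤
      ∫ x, ∏ i ∈ J, Y i x ∂(graphAndNoise n m pv q) := by
    rw [← integral_ind]
    refine integral_mono (hi _) (hi _) fun x => ?_
    simp only
    by_cases hx : x.1.Adj u v ↔ 0 < edgeCount (fun G K => G ⊓ K) J x u v
    · rw [ind_of_false (not_not.2 hx)]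
      exact Finset.prod_nonneg fun i _ => hY0 i x
    · rw [ind_of_true hx]
      refine (Finset.prod_eq_one fun i hiJ => ?_).ge
      have hcount : edgeCount (fun G K => G ⊓ K) J x u v = ∑ i ∈ J, ind (x.1.Adj u v) *
          (pairSampled i u v x * ind (s(u, v) ∈ (x.2 i).2.edgeSet)) := by
        refine Finset.sum_congr rfl fun i _ => ?_
        simp only [pairSampled, ← ind_and, noisyGraph, SimpleGraph.inf_adj, SimpleGraph.mem_edgeSet]
        congr 1
        exact propext (by tauto)
      have hterm : ∀ i, 0 ≤ pairSampled i u v x * ind (s(u, v) ∈ (x.2 i).2.edgeSet) :=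
        fun i => mul_nonneg ind_nonneg ind_nonneg
      by_cases hadj : x.1.Adj u v
      · simp only [ind_of_true hadj, one_mul] at hcount
        have h0 : edgeCount (fun G K => G ⊓ K) J x u v = 0 := by
          refine le_antisymm (not_lt.1 fun h => hx ⟨fun _ => h, fun _ => hadj⟩) ?_
          rw [hcount]
          exact Finset.sum_nonneg fun i _ => hterm i
        rw [hcount, Finset.sum_eq_zero_iff_of_nonneg fun i _ => hterm i] at h0
        simp only [Y, h0 i hiJ, sub_zero]
      · simp only [ind_of_false hadj, zero_mul, Finset.sum_const_zero] at hcount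
        exact (hx ⟨fun h => (hadj h).elim, fun h => (h.ne' hcount).elim⟩).elim
  refine hle.trans ?_
  rw [hprod]
  simp only [hYi, Finset.prod_const]
  have h0 : 0 ≤ 1 - (pv : ℝ) ^ 2 * q := by
    have := mul_le_one₀ (pow_le_one₀ pv.2.1 pv.2.2 : (pv : ℝ) ^ 2 ≤ 1) q.2.1 q.2.2
    linarith
  calc (1 - (pv : ℝ) ^ 2 * q) ^ J.card ≤ Real.exp (-((pv : ℝ) ^ 2 * q)) ^ J.card :=
        pow_le_pow_left₀ h0 (by linarith [Real.add_one_le_exp (-((pv : ℝ) ^ 2 * q))]) _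
    _ = _ := by rw [← Real.exp_nat_mul]; congr 1; ring

/-- In the flip model, the majority vote errs only if at least half of the observations of a pair
are flipped. -/
theorem measureReal_flip_error_le (J : Finset (Fin m)) {u v : Fin n} (huv : u ≠ v)
    (hq : (q : ℝ) ≤ 1 / 2) :
    (graphAndNoise n m pv q).real {x | ¬ (x.1.Adj u v ↔
      seenCount J x u v < 2 * edgeCount (fun G K => symmDiff G K) J x u v)} ≤
      Real.exp (-(J.card * ((pv : ℝ) ^ 2 * (1 / 2 - (q : ℝ)) ^ 2))) := by
  let Y : Fin m → NoiseSpace n m → ℝ := fun i x =>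
    2 * (pairSampled i u v x * ind (s(u, v) ∈ (x.2 i).2.edgeSet)) - pairSampled i u v x
  have hi : ∀ f : NoiseSpace n m → ℝ, Integrable f (graphAndNoise n m pv q) := fun f => .of_finite
  have key := measureReal_le_sum_le_exp (μ := graphAndNoise n m pv q)
    (iIndepFun_noiseBit n m pv q) (F := J) (T := fun i => pairBlock i u v)
    (fun i _ j _ hij => disjoint_pairBlock hij u v) (Y := Y)
    (fun i _ x y h => by
      have h1 := dependsOnBits_mark i u v x y h
      simp only at h1
      simp only [Y, dependsOnBits_pairSampled i u v x y h, h1])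
    (g := 1 - 2 * q) (v := (pv : ℝ) ^ 2) (by linarith) (by linarith [q.2.1]) ?_ ?_ ?_ 0
  · refine (measureReal_mono (fun x hx => ?_) (measure_ne_top _ _)).trans (key.trans_eq ?_)
    · simp only [Set.mem_ofPred_eq] at hx ⊢
      have hsum : ∑ i ∈ J, Y i x = (1 - 2 * ind (x.1.Adj u v)) *
          (2 * edgeCount (fun G K => symmDiff G K) J x u v - seenCount J x u v) := by
        rw [edgeCount, seenCount, Finset.mul_sum, ← Finset.sum_sub_distrib, Finset.mul_sum]
        refine Finset.sum_congr rfl fun i _ => ?_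
        have h1 := ind_mem_edgeSet_symmDiff x.1 (x.2 i).2 s(u, v)
        simp only [SimpleGraph.mem_edgeSet] at h1
        simp only [Y, pairSampled, noisyGraph, ← and_assoc, SimpleGraph.mem_edgeSet]
        rw [ind_and (p := u ∈ (x.2 i).1 ∧ v ∈ (x.2 i).1), h1]
        linear_combination (-4 * ind (u ∈ (x.2 i).1 ∧ v ∈ (x.2 i).1) *
          (2 * ind ((x.2 i).2.Adj u v) - 1)) * ind_sq (p := x.1.Adj u v)
      rw [hsum]
      by_cases hadj : x.1.Adj u v
      · rw [ind_of_true hadj]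
        have : ¬ seenCount J x u v < 2 * edgeCount (fun G K => symmDiff G K) J x u v :=
          fun h => hx ⟨fun _ => h, fun _ => hadj⟩
        linarith
      · rw [ind_of_false hadj]
        have : seenCount J x u v < 2 * edgeCount (fun G K => symmDiff G K) J x u v := by
          by_contra h
          exact hx ⟨fun h' => (hadj h').elim, fun h' => (h h').elim⟩
        linarith
    · congr 1; ring
  · intro i _ x
    simp only [Y, pairSampled, ind]
    split_ifs <;> norm_num
  · intro i _
    simp only [Y]
    rw [integral_sub (hi _) (hi _), integral_const_mul, integral_pairSampled_mul_mark i huv,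
      integral_pairSampled i huv]
    linarith
  · intro i _
    rw [← integral_pairSampled (q := q) i huv]
    refine integral_mono (hi _) (hi _) fun x => ?_
    simp only [Y, pairSampled, ind]
    split_ifs <;> norm_num

end Noise

/-! ### Asymptotics -/

section Asymptotics

open Filter

theorem Real.rpow_pow_eq_inv_pow {x y : ℝ} (hx : 0 ≤ x) (N M : ℕ) (h : y * N = -(M : ℝ)) :
    (x ^ y) ^ N = (x ^ M)⁻¹ := by
  rw [← Real.rpow_natCast (x ^ y) N, ← Real.rpow_mul hx, h, Real.rpow_neg hx, Real.rpow_natCast]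

/-- Reconstruction in the deletion model for a fixed number of vertices. -/
theorem exists_reconstructor_deletion {n m : ℕ} {pv pe : unitInterval} (hn : 4 ≤ n)
    (hpv : 0 < (pv : ℝ)) (hpe : 0 < (pe : ℝ))
    (hC : 61440 * 64 * Real.log n ≤ (pe : ℝ) ^ 6 * ((pv : ℝ) ^ 2 * n)) {m₀ : ℕ} (hm₀m : m₀ ≤ m)
    (hm₀ : 4 * ((pv : ℝ) ^ 2)⁻¹ * (pe : ℝ)⁻¹ * Real.log n ≤ m₀) (hm₀n : m₀ ≤ n ^ 3) :
    ∃ R : Reconstructor n m, 1 - 1 / (n : ℝ) ≤ deletionSuccessProb pv pe R := by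
  obtain ⟨J, -, hJ⟩ := Finset.exists_subset_card_eq (s := (Finset.univ : Finset (Fin m))) (n := m₀)
    (by simpa using hm₀m)
  refine (isNoiseModel_deletion n m pv pe).exists_reconstructor_success hn (by positivity) ?_ ?_
    (J := J) (hJ.trans_le hm₀n) (dec := fun _ t => 0 < t) fun u v huv =>
      (measureReal_deletion_error_le J huv).trans (Real.exp_neg_le_inv_pow (by omega) ?_)
  · have := pow_le_one₀ pe.2.1 pe.2.2 (n := 2)
    nlinarith
  · have : ((pe : ℝ) ^ 2 / 4) ^ 3 = (pe : ℝ) ^ 6 / 64 := by ring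
    rw [this]
    linarith
  · rw [hJ]
    have h : (4 * ((pv : ℝ) ^ 2)⁻¹ * (pe : ℝ)⁻¹ * Real.log n) * ((pv : ℝ) ^ 2 * pe) ≤
        m₀ * ((pv : ℝ) ^ 2 * pe) := mul_le_mul_of_nonneg_right hm₀ (by positivity)
    refine le_trans (le_of_eq ?_) h
    field_simp
    push_cast
    ring

/-- Reconstruction in the flip model for a fixed number of vertices. -/
theorem exists_reconstructor_flip {n m : ℕ} {pv fe : unitInterval} (hn : 4 ≤ n)
    (hpv : 0 < (pv : ℝ)) (hfe : 0 < 1 / 2 - (fe : ℝ))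
    (hC : 61440 * Real.log n ≤ (1 / 2 - (fe : ℝ)) ^ 6 * ((pv : ℝ) ^ 2 * n)) {m₀ : ℕ}
    (hm₀m : m₀ ≤ m)
    (hm₀ : 12 * ((pv : ℝ) ^ 2)⁻¹ * ((1 / 2 - (fe : ℝ)) ^ 2)⁻¹ * Real.log n ≤ m₀)
    (hm₀n : m₀ ≤ n ^ 3) :
    ∃ R : Reconstructor n m, 1 - 1 / (n : ℝ) ≤ flipSuccessProb pv fe R := by
  obtain ⟨J, -, hJ⟩ := Finset.exists_subset_card_eq (s := (Finset.univ : Finset (Fin m))) (n := m₀)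
    (by simpa using hm₀m)
  have hlog : 0 ≤ Real.log n := Real.log_natCast_nonneg n
  refine (isNoiseModel_flip n m pv fe).exists_reconstructor_success hn (by positivity) ?_ ?_
    (J := J) (hJ.trans_le hm₀n) (dec := fun s t => s < 2 * t) fun u v huv =>
      (measureReal_flip_error_le J huv (by linarith)).trans
        (Real.exp_neg_le_inv_pow (by omega) ?_)
  · nlinarith [fe.2.1]
  · rw [← pow_mul]
    exact hC
  · rw [hJ]
    have h : (12 * ((pv : ℝ) ^ 2)⁻¹ * ((1 / 2 - (fe : ℝ)) ^ 2)⁻¹ * Real.log n) *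
        ((pv : ℝ) ^ 2 * (1 / 2 - (fe : ℝ)) ^ 2) ≤ m₀ * ((pv : ℝ) ^ 2 * (1 / 2 - (fe : ℝ)) ^ 2) :=
      mul_le_mul_of_nonneg_right hm₀ (by positivity)
    refine le_trans ?_ h
    have e : (12 * ((pv : ℝ) ^ 2)⁻¹ * ((1 / 2 - (fe : ℝ)) ^ 2)⁻¹ * Real.log n) *
        ((pv : ℝ) ^ 2 * (1 / 2 - (fe : ℝ)) ^ 2) = 12 * Real.log n := by
      have := hfe.ne'
      generalize 1 / 2 - (fe : ℝ) = ε at *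
      field_simp
    rw [e]
    push_cast
    linarith

/-- A number of traces of the order in question is at most polynomial in `n`. -/
theorem natCeil_le_pow_three {n : ℕ} {A B C : ℝ} (hn : 4 ≤ n) (hA : 0 < A) (hB : 0 < B)
    (hA' : 1 ≤ A * n) (hB' : 1 ≤ B * n) (hC : C ≤ 12)
    (hlog : 13 * Real.log n ≤ n) : ⌈C * A⁻¹ * B⁻¹ * Real.log n⌉₊ ≤ n ^ 3 := by
  have hn4 : (4 : ℝ) ≤ n := by exact_mod_cast hn
  have hl0 : 0 ≤ Real.log n := Real.log_natCast_nonneg n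
  have hA1 : A⁻¹ ≤ n := by rwa [inv_le_iff_one_le_mul₀ hA, mul_comm]
  have hB1 : B⁻¹ ≤ n := by rwa [inv_le_iff_one_le_mul₀ hB, mul_comm]
  refine Nat.ceil_le.2 ?_
  push_cast
  calc C * A⁻¹ * B⁻¹ * Real.log n ≤ 12 * n * n * (n / 13) := by
        gcongr
        linarith
    _ ≤ (n : ℝ) ^ 3 := by
        have : (0 : ℝ) ≤ (n : ℝ) ^ 3 := by positivity
        nlinarith

/-- A signal strong enough for the alignment is not too small. -/
theorem pos_and_one_le_pow_mul {n k : ℕ} {t p : ℝ} (hn : 4 ≤ n) (ht : 0 ≤ t) (ht1 : t ≤ 1)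
    (hp1 : p ^ 2 ≤ 1) (hC : 61440 * Real.log n ≤ t ^ 6 * (p ^ 2 * n)) (hk : k ≤ 6) :
    0 < t ∧ 1 ≤ t ^ k * n := by
  have hlog : 1 ≤ Real.log n := one_le_log_natCast hn
  have h1 : t ^ 6 * (p ^ 2 * n) ≤ t ^ 6 * (1 * n) := by gcongr
  have h2 : t ^ 6 * n ≤ t ^ k * n :=
    mul_le_mul_of_nonneg_right (pow_le_pow_of_le_one ht ht1 hk) n.cast_nonneg
  refine ⟨ht.lt_of_ne fun h => ?_, by linarith⟩
  rw [← h] at hC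
  norm_num at hC
  linarith

theorem eventually_log_le : ∀ᶠ n : ℕ in atTop, 13 * Real.log n ≤ n := by
  have h := (Real.isLittleO_log_id_atTop.comp_tendsto tendsto_natCast_atTop_atTop).bound
    (show (0 : ℝ) < 1 / 13 by norm_num)
  filter_upwards [h] with n hn
  simp only [Function.comp, id, Real.norm_eq_abs, Nat.abs_cast] at hn
  linarith [le_abs_self (Real.log n)]

/-- The expected number of common vertices of two traces is at least `1`. -/
theorem eventually_one_le_sq_mul {pv : ℕ → unitInterval}
    (hpv : (fun n : ℕ => Real.log n / Real.sqrt n) =o[atTop] fun n => (pv n : ℝ)) :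
    ∀ᶠ n : ℕ in atTop, 0 < (pv n : ℝ) ∧ 1 ≤ (pv n : ℝ) ^ 2 * n := by
  filter_upwards [hpv.bound one_pos, eventually_ge_atTop 4] with n h hn
  have hn4 : (4 : ℝ) ≤ n := by exact_mod_cast hn
  have hlog : 1 ≤ Real.log n := one_le_log_natCast hn
  have hs : 0 < Real.sqrt n := Real.sqrt_pos.2 (by linarith)
  rw [Real.norm_of_nonneg (by positivity), Real.norm_of_nonneg (pv n).2.1, one_mul,
    div_le_iff₀ hs] at h
  have h1 : 1 ≤ (pv n : ℝ) * Real.sqrt n := hlog.trans h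
  refine ⟨pos_of_mul_pos_left (by linarith) hs.le, ?_⟩
  have h2 : ((pv n : ℝ) * Real.sqrt n) ^ 2 = (pv n : ℝ) ^ 2 * n := by
    rw [mul_pow, Real.sq_sqrt (by linarith)]
  rw [← h2]
  exact one_le_pow₀ h1

/-- The hypothesis on `pe` makes the alignment signal of the deletion model strong enough. -/
theorem eventually_deletion_signal {pv pe : ℕ → unitInterval}
    (hpv : ∀ᶠ n : ℕ in atTop, 0 < (pv n : ℝ) ∧ 1 ≤ (pv n : ℝ) ^ 2 * n)
    (hpe : (fun n : ℕ => (pv n : ℝ) ^ (-(1 / 3) : ℝ) * (n : ℝ) ^ (-(1 / 6) : ℝ) *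
          Real.sqrt (Real.log n)) =o[atTop] (fun n => (pe n : ℝ))) :
    ∀ᶠ n : ℕ in atTop,
      61440 * 64 * Real.log n ≤ (pe n : ℝ) ^ 6 * ((pv n : ℝ) ^ 2 * n) := by
  filter_upwards [hpe.bound (show (0 : ℝ) < 1 / 13 by norm_num), hpv, eventually_ge_atTop 4]
    with n h hp hn
  have hn4 : (4 : ℝ) ≤ n := by exact_mod_cast hn
  have hn0 : (0 : ℝ) < n := by linarith
  have hlog : 1 ≤ Real.log n := one_le_log_natCast hn
  have hpos := hp.1
  rw [Real.norm_of_nonneg (by positivity), Real.norm_of_nonneg (pe n).2.1] at h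
  have h6 := pow_le_pow_left₀ (by positivity) h 6
  rw [mul_pow, mul_pow, Real.rpow_pow_eq_inv_pow hpos.le 6 2 (by norm_num),
    Real.rpow_pow_eq_inv_pow hn0.le 6 1 (by norm_num), pow_one, mul_pow,
    show Real.sqrt (Real.log n) ^ 6 = Real.log n ^ 3 by
      rw [show 6 = 2 * 3 by norm_num, pow_mul, Real.sq_sqrt (by linarith)],
    ← mul_inv, inv_mul_le_iff₀ (by positivity)] at h6
  have hl3 : Real.log n ≤ Real.log n ^ 3 := le_self_pow₀ hlog (by norm_num)
  nlinarith

/-- The hypothesis on `fe` makes the alignment signal of the flip model strong enough. -/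
theorem eventually_flip_signal {pv fe : ℕ → unitInterval}
    (hpv : ∀ᶠ n : ℕ in atTop, 0 < (pv n : ℝ) ∧ 1 ≤ (pv n : ℝ) ^ 2 * n)
    (hfe : ∀ᶠ n : ℕ in atTop, (fe n : ℝ) ≤ 1 / 2)
    (hfe' : (fun n : ℕ => (pv n : ℝ) ^ (-(1 / 4) : ℝ) * (n : ℝ) ^ (-(1 / 8) : ℝ) *
          (Real.log n) ^ (3 / 8 : ℝ)) =o[atTop] (fun n => 1 / 2 - (fe n : ℝ))) :
    ∀ᶠ n : ℕ in atTop, 0 ≤ 1 / 2 - (fe n : ℝ) ∧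
      61440 * Real.log n ≤ (1 / 2 - (fe n : ℝ)) ^ 6 * ((pv n : ℝ) ^ 2 * n) := by
  filter_upwards [hfe'.bound (show (0 : ℝ) < 1 / 4 by norm_num), hpv, hfe, eventually_ge_atTop 4]
    with n h hp hf hn
  have hn4 : (4 : ℝ) ≤ n := by exact_mod_cast hn
  have hn0 : (0 : ℝ) < n := by linarith
  have hlog : 1 ≤ Real.log n := one_le_log_natCast hn
  have hpos := hp.1
  have hε : 0 ≤ 1 / 2 - (fe n : ℝ) := by linarith
  refine ⟨hε, ?_⟩
  rw [Real.norm_of_nonneg (by positivity), Real.norm_of_nonneg hε] at h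
  have h8 := pow_le_pow_left₀ (by positivity) h 8
  rw [mul_pow, mul_pow, Real.rpow_pow_eq_inv_pow hpos.le 8 2 (by norm_num),
    Real.rpow_pow_eq_inv_pow hn0.le 8 1 (by norm_num), pow_one, mul_pow,
    show (Real.log n ^ (3 / 8 : ℝ)) ^ 8 = Real.log n ^ 3 by
      rw [← Real.rpow_natCast, ← Real.rpow_mul (by linarith), ← Real.rpow_natCast]
      norm_num,
    ← mul_inv, inv_mul_le_iff₀ (by positivity)] at h8
  have hl3 : Real.log n ≤ Real.log n ^ 3 := le_self_pow₀ hlog (by norm_num)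
  have h86 : (1 / 2 - (fe n : ℝ)) ^ 8 ≤ (1 / 2 - (fe n : ℝ)) ^ 6 :=
    pow_le_pow_of_le_one hε (by linarith [(fe n).2.1]) (by norm_num)
  have h86' := mul_le_mul_of_nonneg_right h86 (show 0 ≤ (pv n : ℝ) ^ 2 * n by positivity)
  nlinarith

end Asymptotics

theorem theorem1p1 (pv : ℕ → unitInterval)
    (hpv : (fun n : ℕ => Real.log n / Real.sqrt n) =o[Filter.atTop] fun n => (pv n : ℝ)) :
    (∀ pe : ℕ → unitInterval,
      (fun n : ℕ => (pv n : ℝ) ^ (-(1 / 3) : ℝ) * (n : ℝ) ^ (-(1 / 6) : ℝ) *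
          Real.sqrt (Real.log n)) =o[Filter.atTop] (fun n => (pe n : ℝ)) →
      ∀ᶠ n : ℕ in Filter.atTop, ∀ m : ℕ,
        4 * ((pv n : ℝ) ^ 2)⁻¹ * (pe n : ℝ)⁻¹ * Real.log n ≤ m →
        ∃ R : Reconstructor n m, 1 - 1 / (n : ℝ) ≤ deletionSuccessProb (pv n) (pe n) R) ∧
    (∀ fe : ℕ → unitInterval, (∀ᶠ n : ℕ in Filter.atTop, (fe n : ℝ) ≤ 1 / 2) →
      (fun n : ℕ => (pv n : ℝ) ^ (-(1 / 4) : ℝ) * (n : ℝ) ^ (-(1 / 8) : ℝ) *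
          (Real.log n) ^ (3 / 8 : ℝ)) =o[Filter.atTop] (fun n => 1 / 2 - (fe n : ℝ)) →
      ∀ᶠ n : ℕ in Filter.atTop, ∀ m : ℕ,
        12 * ((pv n : ℝ) ^ 2)⁻¹ * ((1 / 2 - (fe n : ℝ)) ^ 2)⁻¹ * Real.log n ≤ m →
        ∃ R : Reconstructor n m, 1 - 1 / (n : ℝ) ≤ flipSuccessProb (pv n) (fe n) R) := by
  have hp := eventually_one_le_sq_mul hpv
  refine ⟨fun pe hpe => ?_, fun fe hfe hfe' => ?_⟩
  · filter_upwards [hp, eventually_deletion_signal hp hpe, eventually_log_le,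
      Filter.eventually_ge_atTop 4] with n hpn hC hlog hn m hm
    have hl0 : 0 ≤ Real.log n := Real.log_natCast_nonneg n
    obtain ⟨h1, h2⟩ := pos_and_one_le_pow_mul (k := 1) hn (pe n).2.1 (pe n).2.2
      (pow_le_one₀ (pv n).2.1 (pv n).2.2) (by linarith) (by norm_num)
    rw [pow_one] at h2
    refine exists_reconstructor_deletion hn hpn.1 h1 hC (Nat.ceil_le.2 hm) (Nat.le_ceil _) ?_
    exact natCeil_le_pow_three hn (pow_pos hpn.1 2) h1 hpn.2 h2 (by norm_num) hlog
  · filter_upwards [hp, eventually_flip_signal hp hfe hfe', eventually_log_le,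
      Filter.eventually_ge_atTop 4] with n hpn hC hlog hn m hm
    obtain ⟨h1, h2⟩ := pos_and_one_le_pow_mul (k := 2) hn hC.1 (by linarith [(fe n).2.1])
      (pow_le_one₀ (pv n).2.1 (pv n).2.2) hC.2 (by norm_num)
    refine exists_reconstructor_flip hn hpn.1 h1 hC.2 (Nat.ceil_le.2 hm) (Nat.le_ceil _) ?_
    exact natCeil_le_pow_three hn (pow_pos hpn.1 2) (pow_pos h1 2) hpn.2 h2
      (by norm_num) hlog
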